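/- Let $n,m,k,l\ge 0$ be integers with $m,k\le n$ and $m+k-n\le l\le \min(m,k)$; put $M:=m-l$, $N:=n-m-k+l$, and let $0\le x\le\lfloor n/2\rfloor$. Let $\mathfrak S_n$ act on $(\mathbb C^2)^{\otimes n}$ by permutation of tensor factors, $\pi(g)|i_1\cdots i_n\rangle=|i_{g^{-1}(1)}\cdots i_{g^{-1}(n)}\rangle$, and let $\mathsf P_{(n-x,x)}$ be the orthogonal projector onto the isotypic component of the irreducible representation $\mathcal V_{(n-x,x)}$ of $\mathfrak S_n$ with character $\chi^{(n-x,x)}$. Put $|\Xi_{n,m|k,l}\rangle:=|1^l0^{k-l}\rangle\otimes|\Xi_{N+M,M}\rangle$, where $|\Xi_{N+M,M}\rangle=\binom{N+M}{M}^{-1/2}\sum_w |w\rangle$ with $w$ running over the words in $\{0,1\}^{N+M}$ with exactly $M$ letters $1$, and define $$p(x):=\langle\Xi_{n,m|k,l}|\,\mathsf P_{(n-x,x)}\,|\Xi_{n,m|k,l}\rangle .$$ **Theorem 4.1 (Hahn presentation).** Assume $m\le n-m$. If $x\le m$, then $$p(x)=\frac{\binom nx}{\binom nm}\,\frac{n-2x+1}{n-x+1}\sum_{i=0}^{\min(M,N)}\binom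 Mi\binom Ni\,\omega_{(n-x,x)}(i),$$ where, for $0\le i\le m$, $$\omega_{(n-x,x)}(i)=\binom mi^{-1}\binom{n-m}i^{-1}\sum_{r=0}^{\min(i,x)}(-1)^r\binom xr\binom{m-x}{i-r}\binom{n-m-x}{i-r}.$$ Moreover, $\omega_{(n-x,x)}$ is the zonal spherical function of the Gelfand pair $(\mathfrak S_n,K)$, $K=\mathfrak S_m\times\mathfrak S_{n-m}$, belonging to $\chi^{(n-x,x)}$: with $J_0=\{1,\dots,m\}$, for every $g\in\mathfrak S_n$, $$\frac1{|K|}\sum_{h\in K}\chi^{(n-x,x)}(hg^{-1})=\omega_{(n-x,x)}(i),\qquad i=m-|J_0\cap g(J_0)|;$$ and it is a Hahn polynomial: for $0\le i\le m$, $$\omega_{(n-x,x)}(i)=Q_x(i;m-n-1,-m-1,m)=\sum_{r=0}^{x}\frac{(-x)_r(x-n-1)_r(-i)_r}{r!\,(m-n)_r(-m)_r},$$ where $(a)_r=a(a+1)\cdots(a+r-1)$. If $m<x$, then $p(x)=0$. -/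

import Mathlib

namespace HahnPresentation

noncomputable section

/-! ## Irreducible representations of the symmetric group -/

/-- A filling `T` places the letter `j` in the box of row `(T j).1` and column `(T j).2`.
The Young symmetrizer of `T`: the signed sum over the permutations that preserve every column,
times the sum over the permutations that preserve every row. -/
def youngSymmetrizer {n : ℕ} (T : Fin n → ℕ × ℕ) : MonoidAlgebra ℂ (Equiv.Perm (Fin n)) :=
  (∑ h : Equiv.Perm (Fin n) with ∀ j, (T (h j)).2 = (T j).2,
      MonoidAlgebra.single h (((Equiv.Perm.sign h : ℤ)) : ℂ)) *
  (∑ h : Equiv.Perm (Fin n) with ∀ j, (T (h j)).1 = (T j).1,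
      MonoidAlgebra.single h (1 : ℂ))

/-- The standard filling of the Young diagram with rows of lengths `n - x` and `x`
(a partition if `2 * x ≤ n`), row by row. -/
def twoRowFilling (n x : ℕ) : Fin n → ℕ × ℕ := fun j =>
  if (j : ℕ) < n - x then (0, (j : ℕ)) else (1, (j : ℕ) - (n - x))

/-- The irreducible representation `V_(n-x,x)` of the symmetric group (Specht module): the left
ideal of the group algebra generated by the Young symmetrizer of the partition `(n-x,x)`. -/
def irrep (n x : ℕ) :
    Submodule (MonoidAlgebra ℂ (Equiv.Perm (Fin n))) (MonoidAlgebra ℂ (Equiv.Perm (Fin n))) :=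
  Submodule.span _ {youngSymmetrizer (twoRowFilling n x)}

/-- The character of `V_(n-x,x)`: the trace of the action of `g`. -/
def irrepCharacter (n x : ℕ) (g : Equiv.Perm (Fin n)) : ℂ :=
  LinearMap.trace ℂ (irrep n x)
    (Algebra.lsmul ℂ ℂ (irrep n x) (MonoidAlgebra.of ℂ (Equiv.Perm (Fin n)) g))

/-! ## The `n`-qubit space and the probability mass function -/

/-- The Hilbert space `(ℂ²)^{⊗ n}`, in coordinates with respect to its orthonormal basis
`|i₁ … iₙ⟩`, where every `iⱼ` is `0` or `1`. -/
abbrev Qubits (n : ℕ) : Type := EuclideanSpace ℂ (Fin n → Fin 2)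

/-- The permutation of tensor factors, `π(g) |i₁ … iₙ⟩ = |i_{g⁻¹(1)} … i_{g⁻¹(n)}⟩`; so the
coefficient of `π(g) v` at a word `w` is that of `v` at `w ∘ g`. -/
def permAction (n : ℕ) : Representation ℂ (Equiv.Perm (Fin n)) (Qubits n) where
  toFun g :=
    { toFun := fun v => WithLp.toLp 2 fun w => v (w ∘ g)
      map_add' := fun _ _ => rfl
      map_smul' := fun _ _ => rfl }
  map_one' := rfl
  map_mul' := fun _ _ => rfl

/-- `permAction` acts on basis vectors as stated. -/
theorem permAction_single (n : ℕ) (g : Equiv.Perm (Fin n)) (i : Fin n → Fin 2) :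
    permAction n g (EuclideanSpace.single i (1 : ℂ)) =
      EuclideanSpace.single (fun j => i (g⁻¹ j)) (1 : ℂ) := by
  ext w
  have h : w ∘ g = i ↔ w = fun j => i (g⁻¹ j) := by
    constructor
    · rintro rfl
      funext j
      simp
    · rintro rfl
      funext j
      simp
  change (EuclideanSpace.single i (1 : ℂ)) (w ∘ g) = _
  simp only [PiLp.single_apply, h]

/-- The isotypic component of type `V_(n-x,x)` in `(ℂ²)^{⊗ n}`. -/
def isotypicSubspace (n x : ℕ) : Submodule ℂ (Qubits n) :=
  ((isotypicComponent (MonoidAlgebra ℂ (Equiv.Perm (Fin n))) (permAction n).asModule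
      (irrep n x)).restrictScalars ℂ).map (permAction n).asModuleEquiv.toLinearMap

/-- The orthogonal projector `P_(n-x,x)` onto that isotypic component. -/
def isotypicProjector (n x : ℕ) : Qubits n →L[ℂ] Qubits n :=
  (isotypicSubspace n x).starProjection

/-- The vector `|Ξ_{n,m|k,l}⟩ = |1^l 0^(k-l)⟩ ⊗ |Ξ_{n-k,m-l}⟩`, where `|Ξ_{n-k,m-l}⟩` is the
Dicke state: `(n-k choose m-l)^(-1/2)` times the sum of all basis vectors of
`(ℂ²)^{⊗ (n-k)}` with exactly `m - l` letters `1`. -/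
def xi (n m k l : ℕ) : Qubits n := WithLp.toLp 2 fun w =>
  (if ∀ j : Fin n, ((j : ℕ) < l → w j = 1) ∧ (l ≤ (j : ℕ) → (j : ℕ) < k → w j = 0)
    then 1 else 0) *
  (if (Finset.univ.filter fun j : Fin n => k ≤ (j : ℕ) ∧ w j = 1).card = m - l
    then ((Real.sqrt ((n - k).choose (m - l)) : ℝ) : ℂ)⁻¹ else 0)

/-- The probability mass function `p(x | n,m,k,l) = ⟨Ξ| P_(n-x,x) |Ξ⟩`. -/
def pmf (n m k l x : ℕ) : ℂ :=
  inner ℂ (xi n m k l) (isotypicProjector n x (xi n m k l))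

/-! ## Zonal spherical functions -/

open Classical in
/-- The zonal spherical function of a pair `(G, K)` belonging to the irreducible character `χ`:
`ω(g) = |K|⁻¹ ∑_{k ∈ K} χ(k g⁻¹)`. -/
def zonalSpherical {G : Type*} [Group G] [Fintype G] (K : Subgroup G) (χ : G → ℂ) (g : G) : ℂ :=
  (Nat.card K : ℂ)⁻¹ * ∑ k : K, χ (k * g⁻¹)

/-- The first `m` letters. -/
def firstLetters (n m : ℕ) : Finset (Fin n) := Finset.univ.filter fun j => (j : ℕ) < m

/-- The subgroup `S_m × S_{n-m}` of `S_n`: the permutations that preserve the set of the first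
`m` letters (and hence its complement). -/
def youngSubgroup (n m : ℕ) : Subgroup (Equiv.Perm (Fin n)) where
  carrier := {g | ∀ j, g j ∈ firstLetters n m ↔ j ∈ firstLetters n m}
  mul_mem' := fun {a b} ha hb j => (ha (b j)).trans (hb j)
  one_mem' := fun _ => Iff.rfl
  inv_mem' := fun {a} ha j => by
    have h := ha (a⁻¹ j)
    have e : a (a⁻¹ j) = j := by simp
    rw [e] at h
    exact h.symm

/-- The distance `m - |J₀ ∩ g(J₀)|`, with `J₀` the set of the first `m` letters. -/
def cosetDistance (n m : ℕ) (g : Equiv.Perm (Fin n)) : ℕ :=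
  m - (firstLetters n m ∩ (firstLetters n m).map g.toEmbedding).card

/-- The function `ω_(n-x,x)(i)`, for `x, i ≤ m ≤ n - m`: the Eberlein polynomial
`∑_r (-1)^r (x choose r) (m-x choose i-r) (n-m-x choose i-r)` divided by
`(m choose i) (n-m choose i)`. -/
def omega (n m x i : ℕ) : ℂ :=
  (m.choose i : ℂ)⁻¹ * ((n - m).choose i : ℂ)⁻¹ *
    ∑ r ∈ Finset.range (min i x + 1),
      (-1 : ℂ) ^ r * (x.choose r : ℂ) * ((m - x).choose (i - r) : ℂ) *
        ((n - m - x).choose (i - r) : ℂ)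

/-- The Hahn polynomial `Q_d(z; a, b, D) = ₃F₂(-d, d+a+b+1, -z; a+1, -D; 1)`, for `d ≤ D`. -/
def hahnPolynomial (d : ℕ) (z a b : ℂ) (D : ℕ) : ℂ :=
  ∑ r ∈ Finset.range (d + 1),
    ((ascPochhammer ℂ r).eval (-(d : ℂ)) * (ascPochhammer ℂ r).eval ((d : ℂ) + a + b + 1) *
      (ascPochhammer ℂ r).eval (-z)) /
    ((r.factorial : ℂ) * (ascPochhammer ℂ r).eval (a + 1) * (ascPochhammer ℂ r).eval (-(D : ℂ)))

end

end HahnPresentation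

/-!
The words of weight `m` span a copy of the permutation module of `m`-subsets, and everything takes
place in one copy of the Specht module `V_(n-x,x)` inside it.

Put a singlet `|01⟩ - |10⟩` on each of the `x` columns of height two of the standard filling, and
symmetrize the remaining letters subject to total weight `m`. The resulting `polytabloid` is a
multiple of the image of a vector under the Young symmetrizer, and conversely the Young symmetrizer
maps every vector to a combination of polytabloids (`youngSymmetrizer_apply_eq_sum`). James'
argument gives that the Specht module is simple (`isSimpleModule_irrep`); hence, for
`x ≤ m ≤ n - x`, it is isomorphic to the module generated by the polytabloid of weight `m`, and by
Maschke's theorem these modules span the isotypic component (`isotypicSubspace_le`). Most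
identities between such vectors follow from `eq_zero_of_antisymmetric`: a function of words that
changes sign under the column transpositions is known from its values at the words with `0` above
`1` in each column.

The operator summing over the words at distance `i` commutes with the group, and the polytabloid is
an eigenvector of it; an evaluation at a single word gives the Eberlein number as the eigenvalue
(`sphereOperator_polytabloid`). So a vector of the Specht copy fixed by the stabilizer of a word
`w₀` is determined by its value at `w₀`: it is a multiple of the `zonalVector`, with entries
`ω(i)`, the eigenvalue over the size of the sphere (`eq_smul_zonalVector`). This has three
consequences.

* The average over `K g⁻¹` acts on the Specht module with rank one, and its trace is the value of
  the zonal vector at a translate of its base word (`zonalSpherical_irrepCharacter`).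
* The zonal vector, divided by its squared norm, is the projection of `|w₀⟩` onto the isotypic
  component (`isotypicProjector_single`). Expanding `|Ξ⟩` into words, `p(x)` becomes a sum over
  pairs of words, counted by their distance (`pmf_eq_sum`).
* The trace of that projection is the dimension of the Specht module, so the squared norm for
  general `m` follows from the one for `m = x`, where `ω(i) = ± 1 / (n-x choose i)` and the
  hockey-stick identity applies (`inv_zonalNormSq`).

If `m < x`, the polytabloids of weight `m` vanish, and so does `p(x)`. The Hahn form of `ω` is an
identity of binomial sums (`eberlein_mul_eq_sum_hahnTerm`): by Pascal's rule the Eberlein numbers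
satisfy `E(x+1, i+1) = E(x, i+1) - E(x, i)`, and the `₃F₂` sums satisfy the same recursion up to a
telescoping term.
-/

namespace HahnPresentation

open Finset

/-! ### Eberlein numbers and sums over exchanges of letters -/

/-- The Eberlein number `∑_r (-1)^r (x choose r) (a choose i-r) (b choose i-r)`: the eigenvalue of
the distance-`i` relation of the Johnson scheme on the `x`-th eigenspace, where `a = m - x` and
`b = n - m - x`. -/
noncomputable def eberlein (x a b i : ℕ) : ℂ :=
  ∑ r ∈ range (i + 1), (-1 : ℂ) ^ r * (x.choose r : ℂ) * (a.choose (i - r) : ℂ) *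
    (b.choose (i - r) : ℂ)

theorem eberlein_zero_left (a b i : ℕ) :
    eberlein 0 a b i = (a.choose i : ℂ) * (b.choose i : ℂ) := by
  rw [eberlein, sum_range_succ']
  simp

theorem eberlein_zero_right (x a b : ℕ) : eberlein x a b 0 = 1 := by
  simp [eberlein]

theorem eberlein_succ_succ (x a b i : ℕ) :
    eberlein (x + 1) a b (i + 1) = eberlein x a b (i + 1) - eberlein x a b i := by
  rw [eberlein, eberlein, sum_range_succ' _ (i + 1), sum_range_succ' _ (i + 1), eberlein,
    add_sub_right_comm, ← sum_sub_distrib]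
  congr 1
  · refine sum_congr rfl fun r _ => ?_
    rw [Nat.choose_succ_succ, Nat.add_sub_add_right]
    push_cast
    ring
  · simp

theorem omega_eq_eberlein (n m x i : ℕ) :
    omega n m x i = (m.choose i : ℂ)⁻¹ * ((n - m).choose i : ℂ)⁻¹ *
      eberlein x (m - x) (n - m - x) i := by
  rw [omega, eberlein]
  congr 1
  refine sum_subset (fun r hr => ?_) fun r _ hr => ?_
  · simp only [mem_range] at hr ⊢
    omega
  · simp only [mem_range] at *
    rw [Nat.choose_eq_zero_of_lt (n := x) (k := r) (by omega)]
    simp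

/-- Exchanging an `i`-set `R` of ones for an `i`-set `S` of zeros, each marked pair
`(α s, β s)` contributes `1` if untouched, `-1` if exchanged, and `0` otherwise. -/
theorem sum_powersetCard_prod_pairs {ι σ : Type*} [DecidableEq ι] [DecidableEq σ] (α β : σ → ι)
    (hα : α.Injective) (hβ : β.Injective) (B C : Finset ι) (hB : ∀ s, β s ∉ B)
    (hC : ∀ s, α s ∉ C) (Q : Finset σ) (i : ℕ) :
    ∑ R ∈ powersetCard i (B ∪ Q.image β), ∑ S ∈ powersetCard i (C ∪ Q.image α),
      ∏ s ∈ Q, ((1 : ℂ) - (if β s ∈ R then 1 else 0) - (if α s ∈ S then 1 else 0)) =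
    eberlein #Q #B #C i := by
  induction Q using Finset.induction_on generalizing i with
  | empty => simp [eberlein_zero_left]
  | insert t Q ht ih =>
    rw [card_insert_of_notMem ht]
    cases i with
    | zero => simp [eberlein_zero_right]
    | succ i =>
      have hb : β t ∉ B ∪ Q.image β := by
        simpa [hB t, hβ.eq_iff] using ht
      have ha : α t ∉ C ∪ Q.image α := by
        simpa [hC t, hα.eq_iff] using ht
      rw [image_insert, image_insert, union_insert, union_insert]
      have split : ∀ (c : ι) (X : Finset ι), c ∉ X → ∀ F : Finset ι → ℂ,
          ∑ R ∈ powersetCard (i + 1) (insert c X), F R =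
            ∑ R ∈ powersetCard (i + 1) X, F R + ∑ R ∈ powersetCard i X, F (insert c R) := by
        intro c X hc F
        have notin : ∀ j, ∀ R ∈ powersetCard j X, c ∉ R := fun j R hR h =>
          hc ((mem_powersetCard.1 hR).1 h)
        rw [powersetCard_succ_insert hc, sum_union, sum_image]
        · intro R hR R' hR' h
          rw [← erase_insert (notin i R hR), ← erase_insert (notin i R' hR')]
          exact congrArg (fun Z => Z.erase c) h
        · rw [disjoint_left]
          intro R hR hR'
          obtain ⟨R', -, rfl⟩ := mem_image.1 hR'
          exact notin _ _ hR (mem_insert_self _ _)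
      have hb' : ∀ j, ∀ R ∈ powersetCard j (B ∪ Q.image β), β t ∉ R := fun j R hR h =>
        hb ((mem_powersetCard.1 hR).1 h)
      have ha' : ∀ j, ∀ S ∈ powersetCard j (C ∪ Q.image α), α t ∉ S := fun j S hS h =>
        ha ((mem_powersetCard.1 hS).1 h)
      have hbi : ∀ s ∈ Q, ∀ R, (β s ∈ insert (β t) R ↔ β s ∈ R) := fun s hs R => by
        rw [mem_insert, or_iff_right]
        exact fun h => ht (hβ h ▸ hs)
      have hai : ∀ s ∈ Q, ∀ S, (α s ∈ insert (α t) S ↔ α s ∈ S) := fun s hs S => by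
        rw [mem_insert, or_iff_right]
        exact fun h => ht (hα h ▸ hs)
      rw [split _ _ hb, eberlein_succ_succ, ← ih (i + 1), ← ih i, sub_eq_add_neg,
        ← sum_neg_distrib]
      congr 1
      · refine sum_congr rfl fun R hR => ?_
        rw [split _ _ ha, add_eq_left.2]
        · refine sum_congr rfl fun S hS => ?_
          rw [prod_insert ht, if_neg (hb' _ _ hR), if_neg (ha' _ _ hS)]
          simp
        · refine sum_eq_zero fun S hS => ?_
          rw [prod_insert ht, if_neg (hb' _ _ hR), if_pos (mem_insert_self _ _)]
          simp
      · refine sum_congr rfl fun R hR => ?_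
        rw [split _ _ ha, add_eq_right.2, ← sum_neg_distrib]
        · refine sum_congr rfl fun S hS => ?_
          rw [prod_insert ht, if_pos (mem_insert_self _ _), if_pos (mem_insert_self _ _),
            prod_congr rfl fun s hs => by rw [if_congr (hbi s hs R) rfl rfl,
              if_congr (hai s hs S) rfl rfl]]
          ring
        · refine sum_eq_zero fun S hS => ?_
          rw [prod_insert ht, if_neg (ha' _ _ hS), if_pos (mem_insert_self _ _)]
          simp

/-! ### Binary words, their weights and distances -/

section Words

variable {ι : Type*} [Fintype ι]

/-- The number of letters `1` of a word. -/
def weight (w : ι → Fin 2) : ℕ := #{j | w j = 1}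

/-- The number of letters `1` of `w` at which `w'` is `0`; the distance in the Johnson scheme if
the two words have the same weight. -/
def wordDist (w w' : ι → Fin 2) : ℕ := #{j | w j = 1 ∧ w' j = 0}

theorem fin2_eq_zero_iff (a : Fin 2) : a = 0 ↔ a ≠ 1 := by omega

theorem fin2_eq_one_iff (a : Fin 2) : a = 1 ↔ a ≠ 0 := by omega

theorem weight_eq_add_wordDist (w w' : ι → Fin 2) :
    weight w = #{j | w j = 1 ∧ w' j = 1} + wordDist w w' := by
  rw [weight, wordDist, ← card_filter_add_card_filter_not (s := {j | w j = 1}) (fun j => w' j = 1),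
    filter_filter, filter_filter]
  simp only [fin2_eq_zero_iff, ne_eq]

theorem wordDist_le_weight (w w' : ι → Fin 2) : wordDist w w' ≤ weight w := by
  have := weight_eq_add_wordDist w w'
  omega

theorem weight_add_wordDist (w w' : ι → Fin 2) :
    weight w + wordDist w' w = weight w' + wordDist w w' := by
  rw [weight_eq_add_wordDist w w', weight_eq_add_wordDist w' w]
  simp only [and_comm (a := w _ = 1) (b := w' _ = 1)]
  ring

theorem card_zeros (w : ι → Fin 2) : #{j | w j = 0} = Fintype.card ι - weight w := by
  have := card_filter_add_card_filter_not (s := (univ : Finset ι)) (fun j => w j = 1)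
  simp only [fin2_eq_zero_iff, ne_eq]
  rw [weight]
  rw [card_univ] at this
  omega

theorem wordDist_self (w : ι → Fin 2) : wordDist w w = 0 := by
  rw [wordDist, card_eq_zero, filter_eq_empty_iff]
  rintro j - ⟨h, h'⟩
  rw [h] at h'
  exact absurd h' (by decide)

theorem weight_comp (w : ι → Fin 2) (g : Equiv.Perm ι) : weight (w ∘ g) = weight w := by
  rw [weight, weight, ← card_map g.toEmbedding]
  congr 1
  ext j
  simp

theorem wordDist_comp (w w' : ι → Fin 2) (g : Equiv.Perm ι) :
    wordDist (w ∘ g) (w' ∘ g) = wordDist w w' := by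
  rw [wordDist, wordDist, ← card_map g.toEmbedding]
  congr 1
  ext j
  simp

/-- Two functions whose fibres have equal sizes differ by a permutation of the domain. -/
theorem exists_perm_comp_eq {κ : Type*} [DecidableEq κ] (f f' : ι → κ)
    (h : ∀ b, #{j | f j = b} = #{j | f' j = b}) : ∃ g : Equiv.Perm ι, f ∘ g = f' := by
  have e : ∀ b, Nonempty ({j // f' j = b} ≃ {j // f j = b}) := fun b => by
    rw [← Fintype.card_eq, Fintype.card_subtype, Fintype.card_subtype, h b]
  let e := fun b => (e b).some
  refine ⟨(Equiv.sigmaFiberEquiv f').symm.trans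
    ((Equiv.sigmaCongrRight e).trans (Equiv.sigmaFiberEquiv f)), ?_⟩
  funext j
  exact (e (f' j) ⟨j, rfl⟩).2

theorem exists_perm_of_weight_eq {w w' : ι → Fin 2} (h : weight w = weight w') :
    ∃ g : Equiv.Perm ι, w ∘ g = w' := by
  refine exists_perm_comp_eq w w' fun b => ?_
  obtain rfl | rfl : b = 1 ∨ b = 0 := by omega
  · exact h
  · rw [card_zeros, card_zeros, h]

/-- The symmetric group acts transitively on pairs of words of given weights and distance. -/
theorem exists_perm_of_wordDist_eq {w₀ w w' : ι → Fin 2} (h : weight w = weight w')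
    (hd : wordDist w₀ w = wordDist w₀ w') :
    ∃ g : Equiv.Perm ι, w₀ ∘ g = w₀ ∧ w ∘ g = w' := by
  have h0 := weight_eq_add_wordDist w₀ w
  have h0' := weight_eq_add_wordDist w₀ w'
  have z (u : ι → Fin 2) := weight_add_wordDist w₀ u
  have h2 (u : ι → Fin 2) :
      #{j | w₀ j = 0} = #{j | w₀ j = 0 ∧ u j = 0} + wordDist u w₀ := by
    rw [wordDist, ← card_filter_add_card_filter_not (s := {j | w₀ j = 0}) (fun j => u j = 0),
      filter_filter, filter_filter]
    simp only [fin2_eq_one_iff, ne_eq, and_comm]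
  obtain ⟨g, hg⟩ := exists_perm_comp_eq (fun j => (w₀ j, w j)) (fun j => (w₀ j, w' j)) (by
    rintro ⟨a, b⟩
    simp only [Prod.mk.injEq]
    have := z w
    have := z w'
    have := h2 w
    have := h2 w'
    obtain rfl | rfl : a = 1 ∨ a = 0 := by omega
    · obtain rfl | rfl : b = 1 ∨ b = 0 := by omega
      · omega
      · exact hd
    · obtain rfl | rfl : b = 1 ∨ b = 0 := by omega
      · simp only [and_comm (a := w₀ _ = 0)]
        change wordDist w w₀ = wordDist w' w₀
        omega
      · omega)
  exact ⟨g, funext fun j => (Prod.ext_iff.1 (congrFun hg j)).1,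
    funext fun j => (Prod.ext_iff.1 (congrFun hg j)).2⟩

variable [DecidableEq ι]

/-- The word `w` with the letters in `R` replaced by `0` and those in `S` by `1`. -/
def exchange (w : ι → Fin 2) (R S : Finset ι) : ι → Fin 2 := fun j =>
  if j ∈ R then 0 else if j ∈ S then 1 else w j

/-- The words of the weight of `w` at distance `i` from `w`. -/
def sphere (w : ι → Fin 2) (i : ℕ) : Finset (ι → Fin 2) :=
  {w' | weight w' = weight w ∧ wordDist w w' = i}

theorem mem_sphere {w w' : ι → Fin 2} {i : ℕ} :
    w' ∈ sphere w i ↔ weight w' = weight w ∧ wordDist w w' = i := by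
  simp [sphere]

theorem sum_sphere {M : Type*} [AddCommMonoid M] (w : ι → Fin 2) (i : ℕ)
    (F : (ι → Fin 2) → M) :
    ∑ w' ∈ sphere w i, F w' =
      ∑ R ∈ powersetCard i {j | w j = 1}, ∑ S ∈ powersetCard i {j | w j = 0},
        F (exchange w R S) := by
  rw [← sum_product']
  have key (R S : Finset ι) (hR : R ⊆ ({j | w j = 1} : Finset ι))
      (hS : S ⊆ ({j | w j = 0} : Finset ι)) :
      ({j | w j = 1 ∧ exchange w R S j = 0} : Finset ι) = R ∧
      ({j | w j = 0 ∧ exchange w R S j = 1} : Finset ι) = S := by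
    simp only [subset_iff, mem_filter_univ] at hR hS
    constructor
    · ext j
      rw [mem_filter_univ, exchange]
      constructor
      · rintro ⟨h1, h2⟩
        by_contra hj
        rw [if_neg hj] at h2
        by_cases hj' : j ∈ S <;> simp [hj', h1] at h2
      · exact fun hj => ⟨hR hj, if_pos hj⟩
    · ext j
      rw [mem_filter_univ, exchange]
      constructor
      · rintro ⟨h1, h2⟩
        by_contra hj'
        rw [if_neg hj'] at h2
        by_cases hj : j ∈ R <;> simp [hj, h1] at h2
      · intro hj
        refine ⟨hS hj, ?_⟩
        rw [if_neg, if_pos hj]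
        intro h
        have := hR h
        rw [hS hj] at this
        exact absurd this (by decide)
  refine sum_bij' (fun w' _ => (({j | w j = 1 ∧ w' j = 0} : Finset ι),
    ({j | w j = 0 ∧ w' j = 1} : Finset ι))) (fun p _ => exchange w p.1 p.2) ?_ ?_ ?_ ?_ ?_
  · intro w' hw'
    obtain ⟨h1, h2⟩ := mem_sphere.1 hw'
    have h3 := weight_add_wordDist w w'
    simp only [mem_product, mem_powersetCard]
    refine ⟨⟨fun j => by simp +contextual, h2⟩, ⟨fun j => by simp +contextual, ?_⟩⟩
    simp only [and_comm (a := w _ = 0)]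
    change wordDist w' w = i
    omega
  · rintro ⟨R, S⟩ hp
    simp only [mem_product, mem_powersetCard] at hp
    obtain ⟨⟨hR, hR'⟩, hS, hS'⟩ := hp
    obtain ⟨k1, k2⟩ := key R S hR hS
    have h1 : wordDist w (exchange w R S) = i := by rw [wordDist, k1, hR']
    have h2 : wordDist (exchange w R S) w = i := by
      rw [wordDist, ← hS', ← congrArg card k2]
      simp only [and_comm]
    have h3 := weight_add_wordDist w (exchange w R S)
    exact mem_sphere.2 ⟨by dsimp only; omega, h1⟩
  · intro w' _
    funext j
    simp only [exchange, mem_filter_univ]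
    rcases (by omega : w j = 1 ∨ w j = 0) with h | h <;>
      rcases (by omega : w' j = 1 ∨ w' j = 0) with h' | h' <;> simp [h, h']
  · rintro ⟨R, S⟩ hp
    simp only [mem_product, mem_powersetCard] at hp
    obtain ⟨k1, k2⟩ := key R S hp.1.1 hp.2.1
    exact Prod.ext k1 k2
  · intro w' hw'
    congr 1
    funext j
    simp only [exchange, mem_filter_univ]
    rcases (by omega : w j = 1 ∨ w j = 0) with h | h <;>
      rcases (by omega : w' j = 1 ∨ w' j = 0) with h' | h' <;> simp [h, h']

theorem card_sphere (w : ι → Fin 2) (i : ℕ) :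
    #(sphere w i) = (weight w).choose i * (Fintype.card ι - weight w).choose i := by
  rw [card_eq_sum_ones, sum_sphere]
  simp only [sum_const, card_powersetCard, card_zeros, smul_eq_mul, mul_one]
  rw [weight]

end Words

/-! ### The Hahn form of the Eberlein numbers -/

/-- The terms of the `₃F₂` sum for the Eberlein numbers, cleared of denominators. -/
noncomputable def hahnTerm (x a b i r : ℕ) : ℂ :=
  (-1 : ℂ) ^ r * (x.choose r : ℂ) * ((a + b + x + 1).descFactorial r : ℂ) *
    (i.descFactorial r : ℂ) * ((a + x - r).factorial : ℂ) * ((b + x - r).factorial : ℂ)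

theorem cast_descFactorial_succ (i r : ℕ) :
    ((i.descFactorial (r + 1) : ℕ) : ℂ) = ((i : ℂ) - r) * (i.descFactorial r : ℂ) := by
  rw [Nat.descFactorial_succ]
  rcases le_or_gt r i with h | h
  · push_cast [h]
    ring
  · rw [Nat.descFactorial_eq_zero_iff_lt.2 h]
    simp

theorem mul_cast_descFactorial_pred (i r : ℕ) :
    ((i + 1 : ℕ) : ℂ) * (i.descFactorial r : ℂ) =
      ((i + 1 : ℕ) - (r : ℂ)) * ((i + 1).descFactorial r : ℂ) := by
  rw [← cast_descFactorial_succ, Nat.succ_descFactorial_succ]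
  push_cast
  ring

theorem cast_choose_succ_mul (x r : ℕ) :
    ((r : ℂ) + 1) * (x.choose (r + 1) : ℂ) = ((x : ℂ) - r) * (x.choose r : ℂ) := by
  rcases le_or_gt r x with h | h
  · have := Nat.choose_succ_right_eq x r
    have := congrArg (Nat.cast : ℕ → ℂ) this
    push_cast [h] at this
    linear_combination this
  · rw [Nat.choose_eq_zero_of_lt h, Nat.choose_eq_zero_of_lt (by omega)]
    simp

/-- The primitive that makes the recursion `hahnTerm_succ` telescope. -/
noncomputable def hahnPrimitive (x a b i : ℕ) : ℕ → ℂ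
  | 0 => 0
  | r + 1 => hahnTerm x a b i r * ((i : ℂ) - r) * ((a : ℂ) + b + 2 * x + 2 - r)

theorem hahnTerm_succ (x a b i r : ℕ) (hr : r ≤ x + 1) :
    hahnTerm (x + 1) a b i r =
      hahnTerm x a b i r * (((a : ℂ) + x + 1 - i) * ((b : ℂ) + x + 1 - i) - i * (i - r)) +
        (hahnPrimitive x a b i (r + 1) - hahnPrimitive x a b i r) := by
  cases r with
  | zero =>
    simp only [hahnTerm, hahnPrimitive, ← add_assoc, Nat.sub_zero, Nat.factorial_succ]
    push_cast
    simp
    ring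
  | succ s =>
    -- All terms are multiples of the common factor with index `s`.
    have e1 : (((a + b + (x + 1) + 1).descFactorial (s + 1) : ℕ) : ℂ) =
        ((a : ℂ) + b + x + 2) * ((a + b + x + 1).descFactorial s : ℂ) := by
      rw [show a + b + (x + 1) + 1 = (a + b + x + 1) + 1 by ring, Nat.succ_descFactorial_succ]
      push_cast
      ring
    have e2 := cast_descFactorial_succ i s
    have e3 := cast_descFactorial_succ (a + b + x + 1) s
    have e4 := cast_choose_succ_mul x s
    have e5 : (((x + 1).choose (s + 1) : ℕ) : ℂ) = x.choose s + x.choose (s + 1) := by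
      rw [Nat.choose_succ_succ]
      push_cast
      ring
    have hs : ((s : ℂ) + 1) ≠ 0 := by exact_mod_cast Nat.succ_ne_zero s
    have e6 : (x.choose (s + 1) : ℂ) = ((x : ℂ) - s) / (s + 1) * x.choose s := by
      field_simp
      linear_combination e4
    simp only [hahnTerm, hahnPrimitive, e1, e2, e3, e5,
      show a + (x + 1) - (s + 1) = a + x - s by omega,
      show b + (x + 1) - (s + 1) = b + x - s by omega]
    rcases Nat.lt_or_ge s x with h | h
    · obtain ⟨A, hA⟩ : ∃ A, a + x - s = A + 1 := ⟨a + x - s - 1, by omega⟩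
      obtain ⟨B, hB⟩ : ∃ B, b + x - s = B + 1 := ⟨b + x - s - 1, by omega⟩
      rw [hA, hB, show a + x - (s + 1) = A by omega, show b + x - (s + 1) = B by omega, e6,
        Nat.factorial_succ, Nat.factorial_succ]
      have hA' : (a : ℂ) + x - s = A + 1 := by
        have := congrArg (Nat.cast : ℕ → ℂ) hA
        push_cast [show s ≤ a + x by omega] at this
        exact this
      have hB' : (b : ℂ) + x - s = B + 1 := by
        have := congrArg (Nat.cast : ℕ → ℂ) hB
        push_cast [show s ≤ b + x by omega] at this
        exact this
      have ha : (a : ℂ) = A + 1 - x + s := by linear_combination hA'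
      have hb : (b : ℂ) = B + 1 - x + s := by linear_combination hB'
      push_cast
      rw [ha, hb]
      field_simp
      ring
    · obtain rfl : s = x := by omega
      rw [Nat.choose_succ_self]
      push_cast
      simp
      ring

theorem sum_hahnTerm_succ (x a b i : ℕ) :
    ∑ r ∈ range (x + 2), hahnTerm (x + 1) a b i r =
      ∑ r ∈ range (x + 1), hahnTerm x a b i r *
        (((a : ℂ) + x + 1 - i) * ((b : ℂ) + x + 1 - i) - i * (i - r)) := by
  rw [sum_congr rfl fun r hr => hahnTerm_succ x a b i r (by simp at hr; omega),
    sum_add_distrib, sum_range_sub, sum_range_succ]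
  have h : hahnTerm x a b i (x + 1) = 0 := by simp [hahnTerm]
  simp [hahnPrimitive, h]

/-- The Hahn form of the Eberlein numbers: both sides satisfy Pascal-type recursions in `x`. -/
theorem eberlein_mul_eq_sum_hahnTerm (x a b i : ℕ) (ha : i ≤ a + x) (hb : i ≤ b + x) :
    eberlein x a b i * ((i.factorial : ℂ) ^ 2 * ((a + x - i).factorial : ℂ) *
      ((b + x - i).factorial : ℂ)) = ∑ r ∈ range (x + 1), hahnTerm x a b i r := by
  induction x generalizing i with
  | zero =>
    have h1 := congrArg (Nat.cast : ℕ → ℂ) (Nat.choose_mul_factorial_mul_factorial ha)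
    have h2 := congrArg (Nat.cast : ℕ → ℂ) (Nat.choose_mul_factorial_mul_factorial hb)
    push_cast [add_zero] at h1 h2
    simp only [eberlein_zero_left, zero_add, sum_range_one, hahnTerm]
    simp [← h1, ← h2]
    ring
  | succ x ih =>
    rw [sum_hahnTerm_succ]
    cases i with
    | zero =>
      rw [eberlein_zero_right, sum_eq_single_of_mem 0 (by simp)]
      · simp [hahnTerm, ← add_assoc, Nat.factorial_succ]
        ring
      · intro r _ hr
        obtain ⟨r, rfl⟩ := Nat.exists_eq_succ_of_ne_zero hr
        simp [hahnTerm]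
    | succ i =>
      have low := ih i (by omega) (by omega)
      have term (r : ℕ) : hahnTerm x a b i r * ((i : ℂ) + 1) =
          hahnTerm x a b (i + 1) r * ((i : ℂ) + 1 - r) := by
        have := mul_cast_descFactorial_pred i r
        push_cast at this
        simp only [hahnTerm]
        linear_combination (-1 : ℂ) ^ r * (x.choose r : ℂ) *
          ((a + b + x + 1).descFactorial r : ℂ) * ((a + x - r).factorial : ℂ) *
          ((b + x - r).factorial : ℂ) * this
      have low' : ∑ r ∈ range (x + 1), hahnTerm x a b (i + 1) r * ((i : ℂ) + 1 - r) =
          ((i : ℂ) + 1) * ∑ r ∈ range (x + 1), hahnTerm x a b i r := by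
        rw [mul_sum]
        exact sum_congr rfl fun r _ => by rw [← term, mul_comm]
      have high : eberlein x a b (i + 1) * (((i + 1).factorial : ℂ) ^ 2 *
          ((a + x - i).factorial : ℂ) * ((b + x - i).factorial : ℂ)) =
          ((a : ℂ) + x - i) * ((b : ℂ) + x - i) *
            ∑ r ∈ range (x + 1), hahnTerm x a b (i + 1) r := by
        have sub (c : ℕ) (hc : i + 1 ≤ c + x) : ((c + x - i).factorial : ℂ) =
            ((c : ℂ) + x - i) * ((c + x - (i + 1)).factorial : ℂ) := by
          rw [show c + x - i = (c + x - (i + 1)) + 1 by omega, Nat.factorial_succ]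
          push_cast [hc]
          ring
        -- Beyond the range of the induction hypothesis both sides vanish.
        have vanish (c : ℕ) (hc : c + x = i) (h : c = a ∨ c = b) :
            eberlein x a b (i + 1) = 0 := by
          refine sum_eq_zero fun r hr => ?_
          rcases Nat.lt_or_ge x r with hxr | hxr
          · simp [Nat.choose_eq_zero_of_lt hxr]
          · rcases h with rfl | rfl
            · simp [Nat.choose_eq_zero_of_lt (show c < i + 1 - r by omega)]
            · simp [Nat.choose_eq_zero_of_lt (show c < i + 1 - r by omega)]
        rcases Nat.lt_or_ge i (a + x) with h1 | h1
        · rcases Nat.lt_or_ge i (b + x) with h2 | h2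
          · rw [← ih (i + 1) h1 h2, sub a h1, sub b h2]
            ring
          · have : b + x = i := by omega
            rw [vanish b this (Or.inr rfl), ← this]
            simp
        · have : a + x = i := by omega
          rw [vanish a this (Or.inl rfl), ← this]
          simp
      rw [eberlein_succ_succ, show a + (x + 1) - (i + 1) = a + x - i by omega,
        show b + (x + 1) - (i + 1) = b + x - i by omega, sub_mul, high]
      rw [Nat.factorial_succ]
      push_cast
      rw [show ∑ r ∈ range (x + 1), hahnTerm x a b (i + 1) r *
          (((a : ℂ) + x + 1 - (i + 1)) * ((b : ℂ) + x + 1 - (i + 1)) -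
            ((i : ℂ) + 1) * ((i : ℂ) + 1 - r)) =
          ((a : ℂ) + x - i) * ((b : ℂ) + x - i) *
            ∑ r ∈ range (x + 1), hahnTerm x a b (i + 1) r -
          ((i : ℂ) + 1) * ∑ r ∈ range (x + 1), hahnTerm x a b (i + 1) r * ((i : ℂ) + 1 - r) by
        rw [mul_sum, mul_sum, ← sum_sub_distrib]
        exact sum_congr rfl fun r _ => by ring, low', ← low]
      ring

theorem ascPochhammer_eval_neg_cast (i r : ℕ) :
    (ascPochhammer ℂ r).eval (-(i : ℂ)) = (-1) ^ r * (i.descFactorial r : ℂ) := by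
  rw [ascPochhammer_eval_neg_eq_descPochhammer, descPochhammer_eval_eq_descFactorial]

theorem omega_eq_hahnPolynomial (n m x i : ℕ) (hxm : x ≤ m) (hxn : x ≤ n - m) (hm : m ≤ n)
    (him : i ≤ m) (hin : i ≤ n - m) :
    omega n m x i = hahnPolynomial x (i : ℂ) ((m : ℂ) - (n : ℂ) - 1) (-(m : ℂ) - 1) m := by
  have h := eberlein_mul_eq_sum_hahnTerm x (m - x) (n - m - x) i (by omega) (by omega)
  have h1 := congrArg (Nat.cast : ℕ → ℂ) (Nat.choose_mul_factorial_mul_factorial him)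
  have h2 := congrArg (Nat.cast : ℕ → ℂ) (Nat.choose_mul_factorial_mul_factorial hin)
  push_cast at h1 h2
  rw [Nat.sub_add_cancel hxm, Nat.sub_add_cancel hxn] at h
  have f0 (k : ℕ) : (k.factorial : ℂ) ≠ 0 := by exact_mod_cast k.factorial_ne_zero
  have c1 : (m.choose i : ℂ) ≠ 0 := by exact_mod_cast (Nat.choose_pos him).ne'
  have c2 : ((n - m).choose i : ℂ) ≠ 0 := by exact_mod_cast (Nat.choose_pos hin).ne'
  have key : omega n m x i * ((m.factorial : ℂ) * ((n - m).factorial : ℂ)) =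
      ∑ r ∈ range (x + 1), hahnTerm x (m - x) (n - m - x) i r := by
    rw [omega_eq_eberlein, ← h, ← h1, ← h2]
    field_simp
  rw [← mul_left_inj' (mul_ne_zero (f0 m) (f0 (n - m))), key, hahnPolynomial, sum_mul]
  refine sum_congr rfl fun r hr => ?_
  have hrx : r ≤ x := by simp at hr; omega
  have p1 : (x : ℂ) + ((m : ℂ) - n - 1) + (-(m : ℂ) - 1) + 1 = -((n + 1 - x : ℕ) : ℂ) := by
    push_cast [show x ≤ n + 1 by omega]
    ring
  have p2 : (m : ℂ) - n - 1 + 1 = -((n - m : ℕ) : ℂ) := by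
    push_cast [hm]
    ring
  rw [p1, p2]
  simp only [ascPochhammer_eval_neg_cast]
  have q1 := congrArg (Nat.cast : ℕ → ℂ) (Nat.factorial_mul_descFactorial (hrx.trans hxm))
  have q2 := congrArg (Nat.cast : ℕ → ℂ) (Nat.factorial_mul_descFactorial (hrx.trans hxn))
  have q3 := congrArg (Nat.cast : ℕ → ℂ) (Nat.descFactorial_eq_factorial_mul_choose x r)
  push_cast at q1 q2 q3
  have d1 : (m.descFactorial r : ℂ) ≠ 0 := fun h0 => f0 m (by rw [← q1, h0, mul_zero])
  have d2 : ((n - m).descFactorial r : ℂ) ≠ 0 := fun h0 => f0 (n - m) (by rw [← q2, h0, mul_zero])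
  have s1 : ((-1 : ℂ) ^ r) ^ 2 = 1 := by rw [← pow_mul, mul_comm, pow_mul]; simp
  have s0 : (-1 : ℂ) ^ r ≠ 0 := pow_ne_zero _ (by norm_num)
  rw [hahnTerm, show m - x + (n - m - x) + x + 1 = n + 1 - x by omega,
    Nat.sub_add_cancel hxm, Nat.sub_add_cancel hxn, q3, ← q1, ← q2]
  have := f0 r
  field_simp

/-- `∑ᵢ (x choose i) / (N choose i) = (N+1) / (N-x+1)`, by the hockey-stick identity. -/
theorem sum_choose_div_choose (x N : ℕ) (h : x ≤ N) :
    ∑ i ∈ range (x + 1), (x.choose i : ℂ) / (N.choose i : ℂ) = ((N : ℂ) + 1) / (N - x + 1) := by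
  have c0 : (N.choose x : ℂ) ≠ 0 := by exact_mod_cast (Nat.choose_pos h).ne'
  have d0 : (N : ℂ) - x + 1 ≠ 0 := by
    rw [← Nat.cast_sub h]
    exact_mod_cast Nat.succ_ne_zero (N - x)
  have e : ∀ i ∈ range (x + 1), (x.choose i : ℂ) / (N.choose i : ℂ) =
      ((N - i).choose (N - x) : ℂ) / N.choose x := fun i hi => by
    have hi' : i ≤ x := by simp at hi; omega
    have ci : (N.choose i : ℂ) ≠ 0 := by exact_mod_cast (Nat.choose_pos (hi'.trans h)).ne'
    have := congrArg (Nat.cast : ℕ → ℂ) (Nat.choose_mul (n := N) hi')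
    push_cast at this
    rw [div_eq_div_iff ci c0, ← Nat.choose_symm (show N - x ≤ N - i by omega),
      show N - i - (N - x) = x - i by omega]
    linear_combination this
  rw [sum_congr rfl e, ← sum_div, div_eq_div_iff c0 d0]
  have hs : ∑ i ∈ range (x + 1), (N - i).choose (N - x) = (N + 1).choose x := by
    rw [← sum_range_reflect, ← Nat.choose_symm (show x ≤ N + 1 by omega),
      show N + 1 - x = N - x + 1 by omega, ← Nat.sum_Icc_choose]
    rw [← Finset.Ico_add_one_right_eq_Icc, sum_Ico_eq_sum_range,
      show N + 1 - (N - x) = x + 1 by omega]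
    refine sum_congr rfl fun i hi => ?_
    simp only [mem_range] at hi
    congr 1
    omega
  have hs' := congrArg (Nat.cast : ℕ → ℂ) hs
  have ht := congrArg (Nat.cast : ℕ → ℂ) (Nat.add_one_mul_choose_eq N (N - x))
  rw [Nat.choose_symm h, show N - x + 1 = N + 1 - x by omega,
    Nat.choose_symm (show x ≤ N + 1 by omega)] at ht
  push_cast [show x ≤ N + 1 by omega] at hs' ht
  rw [hs']
  linear_combination -ht

/-! ### Tableaux of two rows -/

/-- The box in row `0` and column `s`, for a column `s` of height two. -/
def topBox {n x : ℕ} (hx : 2 * x ≤ n) (s : Fin x) : Fin n := ⟨s, by omega⟩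

/-- The box in row `1` and column `s`. -/
def botBox {n x : ℕ} (hx : 2 * x ≤ n) (s : Fin x) : Fin n := ⟨n - x + s, by omega⟩

/-- The permutations that preserve every column of the standard filling. -/
def columnGroup (n x : ℕ) : Finset (Equiv.Perm (Fin n)) :=
  {h | ∀ j, (twoRowFilling n x (h j)).2 = (twoRowFilling n x j).2}

/-- The permutations that preserve every row of the standard filling. -/
def rowGroup (n x : ℕ) : Finset (Equiv.Perm (Fin n)) :=
  {h | ∀ j, (twoRowFilling n x (h j)).1 = (twoRowFilling n x j).1}

/-- The signed column sum of the standard filling. -/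
noncomputable def columnSum (n x : ℕ) : MonoidAlgebra ℂ (Equiv.Perm (Fin n)) :=
  ∑ h ∈ columnGroup n x, MonoidAlgebra.single h (((Equiv.Perm.sign h : ℤ)) : ℂ)

/-- The row sum of the standard filling. -/
noncomputable def rowSum (n x : ℕ) : MonoidAlgebra ℂ (Equiv.Perm (Fin n)) :=
  ∑ h ∈ rowGroup n x, MonoidAlgebra.single h (1 : ℂ)

theorem youngSymmetrizer_eq (n x : ℕ) :
    youngSymmetrizer (twoRowFilling n x) = columnSum n x * rowSum n x := rfl

section Tableau

variable {n x : ℕ}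

theorem mem_columnGroup {h : Equiv.Perm (Fin n)} :
    h ∈ columnGroup n x ↔ ∀ j, (twoRowFilling n x (h j)).2 = (twoRowFilling n x j).2 := by
  simp [columnGroup]

theorem mem_rowGroup {h : Equiv.Perm (Fin n)} :
    h ∈ rowGroup n x ↔ ∀ j, (n - x ≤ (h j : ℕ) ↔ n - x ≤ (j : ℕ)) := by
  rw [rowGroup, mem_filter_univ]
  simp only [twoRowFilling]
  refine forall_congr' fun j => ?_
  split_ifs with h1 h2 h2 <;> simp <;> omega

theorem one_mem_columnGroup : (1 : Equiv.Perm (Fin n)) ∈ columnGroup n x := by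
  simp [mem_columnGroup]

theorem inv_mem_columnGroup {h : Equiv.Perm (Fin n)} (hh : h ∈ columnGroup n x) :
    h⁻¹ ∈ columnGroup n x := by
  rw [mem_columnGroup] at *
  intro j
  have := hh (h⁻¹ j)
  rw [show h (h⁻¹ j) = j by simp] at this
  exact this.symm

theorem mul_mem_rowGroup {g h : Equiv.Perm (Fin n)} (hg : g ∈ rowGroup n x)
    (hh : h ∈ rowGroup n x) : g * h ∈ rowGroup n x := by
  rw [mem_rowGroup] at *
  intro j
  rw [Equiv.Perm.mul_apply, hg, hh]

theorem inv_mem_rowGroup {h : Equiv.Perm (Fin n)} (hh : h ∈ rowGroup n x) :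
    h⁻¹ ∈ rowGroup n x := by
  rw [mem_rowGroup] at *
  intro j
  have := hh (h⁻¹ j)
  rw [show h (h⁻¹ j) = j by simp] at this
  exact this.symm

theorem card_rowGroup_ne_zero : (#(rowGroup n x) : ℂ) ≠ 0 := by
  have : (1 : Equiv.Perm (Fin n)) ∈ rowGroup n x := by simp [mem_rowGroup]
  exact_mod_cast (card_pos.2 ⟨1, this⟩).ne'

variable (hx : 2 * x ≤ n)

/-- The transposition of the two letters in column `s`. -/
def columnSwap (s : Fin x) : Equiv.Perm (Fin n) := Equiv.swap (topBox hx s) (botBox hx s)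

theorem topBox_val (s : Fin x) : (topBox hx s : ℕ) = s := rfl

theorem botBox_val (s : Fin x) : (botBox hx s : ℕ) = n - x + s := rfl

theorem topBox_ne_botBox (s t : Fin x) : topBox hx s ≠ botBox hx t := by
  simp only [topBox, botBox, ne_eq, Fin.mk.injEq]
  omega

theorem topBox_injective : Function.Injective (topBox hx) := by
  intro s t h
  simpa [topBox, Fin.ext_iff] using h

theorem botBox_injective : Function.Injective (botBox hx) := by
  intro s t h
  simpa [botBox, Fin.ext_iff] using h

theorem columnSwap_apply_topBox (s : Fin x) : columnSwap hx s (topBox hx s) = botBox hx s :=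
  Equiv.swap_apply_left _ _

theorem columnSwap_apply_botBox (s : Fin x) : columnSwap hx s (botBox hx s) = topBox hx s :=
  Equiv.swap_apply_right _ _

theorem columnSwap_apply_topBox_of_ne {s t : Fin x} (h : t ≠ s) :
    columnSwap hx s (topBox hx t) = topBox hx t :=
  Equiv.swap_apply_of_ne_of_ne (fun e => h (topBox_injective hx e)) (topBox_ne_botBox hx t s)

theorem columnSwap_apply_botBox_of_ne {s t : Fin x} (h : t ≠ s) :
    columnSwap hx s (botBox hx t) = botBox hx t :=
  Equiv.swap_apply_of_ne_of_ne (topBox_ne_botBox hx s t).symm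
    (fun e => h (botBox_injective hx e))

theorem column_columnSwap (s : Fin x) (j : Fin n) :
    (twoRowFilling n x (columnSwap hx s j)).2 = (twoRowFilling n x j).2 := by
  have hc : (twoRowFilling n x (topBox hx s)).2 = (twoRowFilling n x (botBox hx s)).2 := by
    have := s.2
    rw [twoRowFilling, twoRowFilling, if_pos (by rw [topBox_val]; omega),
      if_neg (by rw [botBox_val]; omega), botBox_val, topBox_val]
    simp
  rcases eq_or_ne j (topBox hx s) with rfl | h1
  · rw [columnSwap_apply_topBox, hc]
  · rcases eq_or_ne j (botBox hx s) with rfl | h2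
    · rw [columnSwap_apply_botBox, hc]
    · rw [columnSwap, Equiv.swap_apply_of_ne_of_ne h1 h2]

theorem eq_botBox {j : Fin n} (hj : n - x ≤ (j : ℕ)) : ∃ s, j = botBox hx s :=
  ⟨⟨j - (n - x), by omega⟩, by ext; simp [botBox]; omega⟩

theorem eq_topBox {j : Fin n} (hj : (j : ℕ) < x) : ∃ s, j = topBox hx s :=
  ⟨⟨j, hj⟩, by ext; simp [topBox]⟩

/-- A column permutation that preserves the second row is trivial. -/
theorem eq_one_of_mem_columnGroup {h : Equiv.Perm (Fin n)} (hh : h ∈ columnGroup n x)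
    (hb : ∀ s, n - x ≤ (h (botBox hx s) : ℕ)) : h = 1 := by
  rw [mem_columnGroup] at hh
  have fixed (j : Fin n) (hj : n - x ≤ (j : ℕ)) : h j = j := by
    have h1 : n - x ≤ (h j : ℕ) := by
      obtain ⟨s, rfl⟩ := eq_botBox hx hj
      exact hb s
    have h2 := hh j
    simp only [twoRowFilling] at h2
    rw [if_neg (by omega), if_neg (by omega)] at h2
    ext
    dsimp only at h2
    omega
  ext j
  rw [Equiv.Perm.one_apply]
  by_cases hj : n - x ≤ (j : ℕ)
  · rw [fixed j hj]
  · by_cases hj' : n - x ≤ (h j : ℕ)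
    · rw [h.injective (fixed (h j) hj')]
    · have h2 := hh j
      simp only [twoRowFilling] at h2
      rw [if_pos (by omega), if_pos (by omega)] at h2
      exact h2

/-- A word is normalized if every column of height two has `0` above `1`. -/
def IsNormalized (w : Fin n → Fin 2) : Prop := ∀ s, w (botBox hx s) = 1 ∧ w (topBox hx s) = 0

/-- A function of words that changes sign under the column transpositions is determined by its
values at normalized words. -/
theorem eq_zero_of_antisymmetric (y : (Fin n → Fin 2) → ℂ)
    (hanti : ∀ s w, y (w ∘ columnSwap hx s) = -y w) (hnorm : ∀ w, IsNormalized hx w → y w = 0)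
    (w : Fin n → Fin 2) : y w = 0 := by
  induction hc : #{s | w (botBox hx s) = 0} using Nat.strong_induction_on generalizing w with
  | _ c ih =>
    by_cases h : ∃ s, w (topBox hx s) = w (botBox hx s)
    · obtain ⟨s, hs⟩ := h
      have e : w ∘ columnSwap hx s = w := by
        funext j
        rcases eq_or_ne j (topBox hx s) with rfl | h1
        · simp [columnSwap_apply_topBox, hs]
        · rcases eq_or_ne j (botBox hx s) with rfl | h2
          · simp [columnSwap_apply_botBox, hs]
          · simp [columnSwap, Equiv.swap_apply_of_ne_of_ne h1 h2]
      have := hanti s w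
      rw [e] at this
      exact self_eq_neg.1 this
    · push Not at h
      by_cases hw : IsNormalized hx w
      · exact hnorm w hw
      · obtain ⟨s, hs⟩ : ∃ s, w (botBox hx s) = 0 := by
          by_contra! hcon
          exact hw fun s => ⟨by have := hcon s; omega, by have := hcon s; have := h s; omega⟩
        rw [← neg_eq_zero, ← hanti s w]
        refine ih _ ?_ _ rfl
        rw [← hc]
        refine card_lt_card ?_
        rw [ssubset_iff_of_subset]
        · refine ⟨s, by simpa using hs, ?_⟩
          have := h s
          simp only [mem_filter_univ, Function.comp_apply, columnSwap_apply_botBox]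
          rw [← hs]
          exact this
        · intro t
          simp only [mem_filter_univ, Function.comp_apply]
          rcases eq_or_ne t s with rfl | hts
          · exact fun _ => hs
          · rw [columnSwap_apply_botBox_of_ne hx hts]
            exact id

end Tableau

/-! ### The action of the group algebra on words -/

section Action

variable {n x : ℕ}

theorem permAction_apply (g : Equiv.Perm (Fin n)) (v : Qubits n) (w : Fin n → Fin 2) :
    permAction n g v w = v (w ∘ g) := rfl

theorem columnSum_apply (v : Qubits n) (w : Fin n → Fin 2) :
    (permAction n).asAlgebraHom (columnSum n x) v w =
      ∑ h ∈ columnGroup n x, ((Equiv.Perm.sign h : ℤ) : ℂ) * v (w ∘ h) := by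
  simp [columnSum, permAction_apply]

theorem rowSum_apply (v : Qubits n) (w : Fin n → Fin 2) :
    (permAction n).asAlgebraHom (rowSum n x) v w = ∑ h ∈ rowGroup n x, v (w ∘ h) := by
  simp [rowSum, permAction_apply]

theorem asAlgebraHom_apply (z : MonoidAlgebra ℂ (Equiv.Perm (Fin n))) (v : Qubits n)
    (w : Fin n → Fin 2) :
    (permAction n).asAlgebraHom z v w = ∑ g, z.coeff g * v (w ∘ g) := by
  rw [Representation.asAlgebraHom_def, MonoidAlgebra.lift_apply, Finsupp.sum_fintype]
  · simp [permAction_apply]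
  · simp

/-- A subspace stable under the group is stable under the group algebra. -/
theorem asAlgebraHom_mem {P : Submodule ℂ (Qubits n)} (hP : ∀ g, ∀ v ∈ P, permAction n g v ∈ P)
    (z : MonoidAlgebra ℂ (Equiv.Perm (Fin n))) {v : Qubits n} (hv : v ∈ P) :
    (permAction n).asAlgebraHom z v ∈ P := by
  induction z using MonoidAlgebra.induction_on with
  | of g => rw [Representation.asAlgebraHom_of]; exact hP g v hv
  | add a b ha hb => rw [map_add]; exact P.add_mem ha hb
  | smul r a ha => rw [map_smul]; exact P.smul_mem r ha

theorem columnSum_antisymmetric (hx : 2 * x ≤ n) (v : Qubits n) (s : Fin x)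
    (w : Fin n → Fin 2) :
    (permAction n).asAlgebraHom (columnSum n x) v (w ∘ columnSwap hx s) =
      -(permAction n).asAlgebraHom (columnSum n x) v w := by
  rw [columnSum_apply, columnSum_apply, ← sum_neg_distrib]
  refine sum_equiv (Equiv.mulLeft (columnSwap hx s)) (fun h => ?_) fun h _ => ?_
  · simp [mem_columnGroup, column_columnSwap]
  · rw [Equiv.coe_mulLeft, Equiv.Perm.sign_mul, columnSwap,
      Equiv.Perm.sign_swap (topBox_ne_botBox hx s s), Function.comp_assoc]
    simp [Equiv.Perm.coe_mul]

theorem rowSum_comp (v : Qubits n) {g : Equiv.Perm (Fin n)} (hg : g ∈ rowGroup n x)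
    (w : Fin n → Fin 2) :
    (permAction n).asAlgebraHom (rowSum n x) v (w ∘ g) =
      (permAction n).asAlgebraHom (rowSum n x) v w := by
  rw [rowSum_apply, rowSum_apply]
  refine sum_equiv (Equiv.mulLeft g) (fun h => ⟨fun hh => mul_mem_rowGroup hg hh, fun hh => ?_⟩)
    fun h _ => ?_
  · simpa using mul_mem_rowGroup (inv_mem_rowGroup hg) hh
  · rw [Equiv.coe_mulLeft, Equiv.Perm.coe_mul, Function.comp_assoc]

/-! ### Polytabloids of arbitrary weight -/

/-- The vector `⊗ₛ (|01⟩ - |10⟩) ⊗ ∑ |u⟩`, with one singlet in every column of height two and `u`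
running over the words on the other letters that make the total weight `m`. -/
noncomputable def polytabloid (hx : 2 * x ≤ n) (m : ℕ) : Qubits n := WithLp.toLp 2 fun w =>
  if weight w = m then ∏ s, (((w (botBox hx s) : ℕ) : ℂ) - ((w (topBox hx s) : ℕ) : ℂ)) else 0

/-- The sum of the words of weight `m` that are `1` on the second row. -/
noncomputable def secondRowVector (hx : 2 * x ≤ n) (m : ℕ) : Qubits n := WithLp.toLp 2 fun w =>
  if weight w = m ∧ ∀ s, w (botBox hx s) = 1 then 1 else 0

/-- A normalized word of weight `m`. -/
def normalizedWord (n x m : ℕ) : Fin n → Fin 2 := fun j =>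
  if n - x ≤ (j : ℕ) ∨ x ≤ (j : ℕ) ∧ (j : ℕ) < m then 1 else 0

variable (hx : 2 * x ≤ n)

theorem isNormalized_normalizedWord {m : ℕ} : IsNormalized hx (normalizedWord n x m) := by
  intro s
  have := s.2
  rw [normalizedWord, normalizedWord, if_pos (by rw [botBox_val]; omega),
    if_neg (by rw [topBox_val]; omega)]
  simp

theorem weight_normalizedWord {m : ℕ} (h1 : x ≤ m) (h2 : m ≤ n - x) :
    weight (normalizedWord n x m) = m := by
  rw [weight]
  have : ({j | normalizedWord n x m j = 1} : Finset (Fin n)).map Fin.valEmbedding =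
      Ico (n - x) n ∪ Ico x m := by
    ext j
    simp only [mem_map, mem_filter_univ, Fin.valEmbedding_apply, mem_union, mem_Ico]
    constructor
    · rintro ⟨i, hi, rfl⟩
      rw [normalizedWord] at hi
      split_ifs at hi with h
      · omega
      · simp at hi
    · intro hj
      exact ⟨⟨j, by omega⟩, by rw [normalizedWord, if_pos (by dsimp only; omega)], rfl⟩
  rw [← card_map, this, card_union_of_disjoint, Nat.card_Ico, Nat.card_Ico]
  · omega
  · rw [disjoint_left]
    intro j
    simp only [mem_Ico]
    omega

theorem polytabloid_apply (m : ℕ) (w : Fin n → Fin 2) : polytabloid hx m w =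
    if weight w = m then ∏ s, (((w (botBox hx s) : ℕ) : ℂ) - ((w (topBox hx s) : ℕ) : ℂ)) else 0 :=
  rfl

theorem secondRowVector_apply (m : ℕ) (w : Fin n → Fin 2) : secondRowVector hx m w =
    if weight w = m ∧ ∀ s, w (botBox hx s) = 1 then 1 else 0 := rfl

theorem polytabloid_apply_of_isNormalized {m : ℕ} {w : Fin n → Fin 2} (hw : IsNormalized hx w) :
    polytabloid hx m w = if weight w = m then 1 else 0 := by
  rw [polytabloid_apply]
  congr 1
  refine prod_eq_one fun s _ => ?_
  rw [(hw s).1, (hw s).2]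
  simp

theorem polytabloid_antisymmetric (m : ℕ) (s : Fin x) (w : Fin n → Fin 2) :
    polytabloid hx m (w ∘ columnSwap hx s) = -polytabloid hx m w := by
  rw [polytabloid_apply, polytabloid_apply, weight_comp]
  split_ifs
  · rw [← mul_prod_erase univ _ (mem_univ s), ← mul_prod_erase univ _ (mem_univ s),
      ← neg_mul]
    congr 1
    · simp [columnSwap_apply_botBox, columnSwap_apply_topBox]
    · refine prod_congr rfl fun t ht => ?_
      have hts := ne_of_mem_erase ht
      simp [columnSwap_apply_botBox_of_ne hx hts, columnSwap_apply_topBox_of_ne hx hts]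
  · simp

theorem polytabloid_eq_zero_of_lt {m : ℕ} (h : m < x) : polytabloid hx m = 0 := by
  ext w
  refine eq_zero_of_antisymmetric hx _ (fun s w => polytabloid_antisymmetric hx m s w)
    (fun w hw => ?_) w
  rw [polytabloid_apply_of_isNormalized hx hw, if_neg]
  rintro rfl
  have : #(univ.image (botBox hx)) ≤ weight w := by
    refine card_le_card fun j hj => ?_
    obtain ⟨s, -, rfl⟩ := mem_image.1 hj
    simpa using (hw s).1
  rw [card_image_of_injective _ (botBox_injective hx)] at this
  simp at this
  omega

theorem columnSum_secondRowVector (m : ℕ) :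
    (permAction n).asAlgebraHom (columnSum n x) (secondRowVector hx m) = polytabloid hx m := by
  rw [← sub_eq_zero]
  ext w
  refine eq_zero_of_antisymmetric hx (fun w => ((permAction n).asAlgebraHom (columnSum n x)
    (secondRowVector hx m) - polytabloid hx m) w) (fun s w => ?_) (fun w hw => ?_) w
  · simp only [PiLp.sub_apply, columnSum_antisymmetric, polytabloid_antisymmetric]
    ring
  · -- Only the identity keeps a normalized word equal to `1` on the second row.
    rw [PiLp.sub_apply, columnSum_apply, sum_eq_single_of_mem 1 one_mem_columnGroup,
      polytabloid_apply_of_isNormalized hx hw, secondRowVector_apply]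
    · simp [fun s => (hw s).1]
    · intro h hh hne
      rw [secondRowVector_apply, if_neg, mul_zero]
      rintro ⟨-, hb⟩
      refine hne (eq_one_of_mem_columnGroup hx hh fun s => ?_)
      by_contra hlt
      have hcol := mem_columnGroup.1 hh (botBox hx s)
      have := s.2
      simp only [twoRowFilling] at hcol
      rw [if_pos (by omega), if_neg (by simp [botBox])] at hcol
      simp only [botBox, Nat.add_sub_cancel_left] at hcol
      obtain ⟨t, ht⟩ := eq_topBox hx (j := h (botBox hx s)) (by simp only [botBox]; omega)
      have := hb s
      rw [Function.comp_apply, ht, (hw t).2] at this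
      exact absurd this (by decide)

theorem rowSum_secondRowVector (m : ℕ) :
    (permAction n).asAlgebraHom (rowSum n x) (secondRowVector hx m) =
      (#(rowGroup n x) : ℂ) • secondRowVector hx m := by
  ext w
  rw [rowSum_apply, sum_congr rfl (g := fun _ => secondRowVector hx m w)]
  · simp
  · intro h hh
    have hh' := mem_rowGroup.1 hh
    rw [secondRowVector_apply, secondRowVector_apply, weight_comp]
    refine if_congr (and_congr_right fun _ => ⟨fun H s => ?_, fun H s => ?_⟩) rfl rfl
    · obtain ⟨t, ht⟩ := eq_botBox hx (j := h⁻¹ (botBox hx s))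
        ((mem_rowGroup.1 (inv_mem_rowGroup hh) _).2 (by simp [botBox]))
      have := H t
      rwa [Function.comp_apply, ← ht, show h (h⁻¹ (botBox hx s)) = botBox hx s by simp] at this
    · obtain ⟨t, ht⟩ := eq_botBox hx (j := h (botBox hx s)) ((hh' _).2 (by simp [botBox]))
      rw [Function.comp_apply, ht, H t]

theorem youngSymmetrizer_secondRowVector (m : ℕ) :
    (permAction n).asAlgebraHom (youngSymmetrizer (twoRowFilling n x)) (secondRowVector hx m) =
      (#(rowGroup n x) : ℂ) • polytabloid hx m := by
  rw [youngSymmetrizer_eq, map_mul, Module.End.mul_apply, rowSum_secondRowVector, map_smul,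
    columnSum_secondRowVector]

/-- Two normalized words of equal weight differ by a row permutation that commutes with every
column permutation. -/
theorem exists_rowGroup_comp_eq {w w' : Fin n → Fin 2} (hw : IsNormalized hx w)
    (hw' : IsNormalized hx w') (h : weight w = weight w') :
    ∃ g ∈ rowGroup n x, (∀ c ∈ columnGroup n x, g * c = c * g) ∧ w ∘ g = w' := by
  have agree (j : Fin n) (hj : (j : ℕ) < x ∨ n - x ≤ (j : ℕ)) : w j = w' j := by
    rcases hj with hj | hj
    · obtain ⟨s, rfl⟩ := eq_topBox hx hj
      rw [(hw s).2, (hw' s).2]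
    · obtain ⟨s, rfl⟩ := eq_botBox hx hj
      rw [(hw s).1, (hw' s).1]
  let box (j : Fin n) : Option (Fin n) := if (j : ℕ) < x ∨ n - x ≤ (j : ℕ) then some j else none
  have fibre (b : Fin 2) : #{j | w j = b} = #{j | w' j = b} := by
    obtain rfl | rfl : b = 1 ∨ b = 0 := by omega
    · exact h
    · rw [card_zeros, card_zeros, h]
  obtain ⟨g, hg⟩ := exists_perm_comp_eq (fun j => (box j, w j)) (fun j => (box j, w' j)) (by
    rintro ⟨o, b⟩
    have e (u : Fin n → Fin 2) := card_filter_add_card_filter_not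
      (s := ({j | u j = b} : Finset (Fin n))) (fun j => box j = none)
    have e1 := e w
    have e2 := e w'
    rw [filter_filter, filter_filter] at e1 e2
    simp only [Prod.mk.injEq, and_comm (b := _ = b)]
    have inside (o : Option (Fin n)) (ho : o ≠ none) (j : Fin n) (hj : box j = o) :
        w j = w' j := by
      refine agree j ?_
      by_contra hcon
      exact ho (by rw [← hj]; exact if_neg hcon)
    cases o with
    | none =>
      have : #{j | w j = b ∧ ¬ box j = none} = #{j | w' j = b ∧ ¬ box j = none} := by
        congr 1
        ext j
        simp only [mem_filter_univ, and_congr_left_iff]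
        intro hj
        rw [inside _ hj j rfl]
      have := fibre b
      omega
    | some i =>
      congr 1
      ext j
      simp only [mem_filter_univ, and_congr_left_iff]
      intro hj
      rw [inside (some i) (by simp) j hj])
  have hbox (j : Fin n) : box (g j) = box j := (Prod.ext_iff.1 (congrFun hg j)).1
  have hgbox (j : Fin n) (hj : (j : ℕ) < x ∨ n - x ≤ (j : ℕ)) : g j = j := by
    have := hbox j
    simp only [box] at this
    rw [if_pos hj] at this
    split_ifs at this
    simpa using this
  have hgmid (j : Fin n) (hj : ¬ ((j : ℕ) < x ∨ n - x ≤ (j : ℕ))) :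
      ¬ ((g j : ℕ) < x ∨ n - x ≤ (g j : ℕ)) := by
    have := hbox j
    simp only [box] at this
    rw [if_neg hj] at this
    split_ifs at this with h'
    exact h'
  refine ⟨g, mem_rowGroup.2 fun j => ?_, fun c hc => ?_,
    funext fun j => (Prod.ext_iff.1 (congrFun hg j)).2⟩
  · by_cases hj : (j : ℕ) < x ∨ n - x ≤ (j : ℕ)
    · rw [hgbox j hj]
    · have := hgmid j hj
      omega
  · have hcol := mem_columnGroup.1 hc
    have cmid (j : Fin n) (hj : ¬ ((j : ℕ) < x ∨ n - x ≤ (j : ℕ))) : c j = j := by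
      have := hcol j
      simp only [twoRowFilling] at this
      rw [if_pos (show (j : ℕ) < n - x by omega)] at this
      ext
      split_ifs at this <;> dsimp only at this <;> omega
    have cbox (j : Fin n) (hj : (j : ℕ) < x ∨ n - x ≤ (j : ℕ)) :
        (c j : ℕ) < x ∨ n - x ≤ (c j : ℕ) := by
      have := hcol j
      simp only [twoRowFilling] at this
      split_ifs at this <;> dsimp only at this <;> omega
    ext j
    rw [Equiv.Perm.mul_apply, Equiv.Perm.mul_apply]
    by_cases hj : (j : ℕ) < x ∨ n - x ≤ (j : ℕ)
    · rw [hgbox j hj, hgbox _ (cbox j hj)]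
    · rw [cmid j hj, cmid _ (hgmid j hj)]

/-- The Young symmetrizer maps everything into the span of the polytabloids. -/
theorem youngSymmetrizer_apply_eq_sum (u : Qubits n) : ∃ c : ℕ → ℂ,
    (permAction n).asAlgebraHom (youngSymmetrizer (twoRowFilling n x)) u =
      ∑ m ∈ range (n + 1), c m • polytabloid hx m := by
  rw [youngSymmetrizer_eq, map_mul, Module.End.mul_apply]
  set y := (permAction n).asAlgebraHom (columnSum n x)
    ((permAction n).asAlgebraHom (rowSum n x) u) with hy
  have const {w w' : Fin n → Fin 2} (hw : IsNormalized hx w) (hw' : IsNormalized hx w')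
      (h : weight w = weight w') : y w = y w' := by
    obtain ⟨g, hg, hcomm, rfl⟩ := exists_rowGroup_comp_eq hx hw hw' h
    rw [hy, columnSum_apply, columnSum_apply]
    refine sum_congr rfl fun c hc => ?_
    rw [Function.comp_assoc, ← Equiv.Perm.coe_mul, hcomm c hc, Equiv.Perm.coe_mul,
      ← Function.comp_assoc, rowSum_comp _ hg]
  classical
  refine ⟨fun m => if h : ∃ w, IsNormalized hx w ∧ weight w = m then y h.choose else 0, ?_⟩
  rw [← sub_eq_zero]
  ext w
  refine eq_zero_of_antisymmetric hx (fun w => (y - ∑ m ∈ range (n + 1),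
    (if h : ∃ w, IsNormalized hx w ∧ weight w = m then y h.choose else 0) •
      polytabloid hx m) w) (fun s w => ?_) (fun w hw => ?_) w
  · have ha := columnSum_antisymmetric hx ((permAction n).asAlgebraHom (rowSum n x) u) s w
    rw [← hy] at ha
    simp only [PiLp.sub_apply, WithLp.ofLp_sum, Finset.sum_apply, PiLp.smul_apply, ha,
      polytabloid_antisymmetric, smul_neg, sum_neg_distrib]
    ring
  · have hwn : weight w < n + 1 := by
      have := card_filter_le (univ : Finset (Fin n)) (fun j => w j = 1)
      rw [card_univ, Fintype.card_fin] at this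
      exact Nat.lt_succ_of_le this
    have hex : ∃ w', IsNormalized hx w' ∧ weight w' = weight w := ⟨w, hw, rfl⟩
    simp only [PiLp.sub_apply, WithLp.ofLp_sum, Finset.sum_apply, PiLp.smul_apply,
      polytabloid_apply_of_isNormalized hx hw]
    rw [sum_eq_single_of_mem (weight w) (mem_range.2 hwn), if_pos rfl, dif_pos hex,
      const hex.choose_spec.1 hw hex.choose_spec.2]
    · simp
    · intro m _ hm
      rw [if_neg hm.symm, smul_zero]

end Action

/-! ### Copies of the Specht module in the qubit space -/

section Specht

variable {n x : ℕ}

/-- The Young symmetrizer as an element of the Specht module. -/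
noncomputable def irrepGenerator (n x : ℕ) : irrep n x :=
  ⟨youngSymmetrizer (twoRowFilling n x), Submodule.subset_span rfl⟩

theorem exists_smul_irrepGenerator (z : irrep n x) :
    ∃ a : MonoidAlgebra ℂ (Equiv.Perm (Fin n)), a • irrepGenerator n x = z := by
  obtain ⟨a, ha⟩ := Submodule.mem_span_singleton.1 z.2
  exact ⟨a, Subtype.ext ha⟩

/-- Elements of the Specht module are functions on the group invariant under the row group from
the right. -/
theorem coeff_mul_of_mem_rowGroup (z : irrep n x) {h : Equiv.Perm (Fin n)}
    (hh : h ∈ rowGroup n x) (g : Equiv.Perm (Fin n)) :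
    (z : MonoidAlgebra ℂ (Equiv.Perm (Fin n))).coeff (g * h) =
      (z : MonoidAlgebra ℂ (Equiv.Perm (Fin n))).coeff g := by
  obtain ⟨a, rfl⟩ := exists_smul_irrepGenerator z
  have hrow : rowSum n x * MonoidAlgebra.single h⁻¹ 1 = rowSum n x := by
    rw [rowSum, sum_mul]
    refine sum_equiv (Equiv.mulRight h⁻¹) (fun k => ⟨fun hk =>
      mul_mem_rowGroup hk (inv_mem_rowGroup hh), fun hk => ?_⟩) fun k _ => ?_
    · simpa using mul_mem_rowGroup hk hh
    · rw [MonoidAlgebra.single_mul_single, mul_one, Equiv.coe_mulRight]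
  have hz : ((a • irrepGenerator n x : irrep n x) : MonoidAlgebra ℂ (Equiv.Perm (Fin n))) *
      MonoidAlgebra.single h⁻¹ (1 : ℂ) = ((a • irrepGenerator n x : irrep n x) :
        MonoidAlgebra ℂ (Equiv.Perm (Fin n))) := by
    change a * youngSymmetrizer (twoRowFilling n x) * MonoidAlgebra.single h⁻¹ 1 =
      a * youngSymmetrizer (twoRowFilling n x)
    rw [youngSymmetrizer_eq, mul_assoc, mul_assoc, hrow]
  conv_rhs => rw [← hz]
  rw [MonoidAlgebra.coeff_mul_single_apply, inv_inv, mul_one]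

variable (hx : 2 * x ≤ n)

/-- The homomorphism from the Specht module to the qubit space that sends the Young symmetrizer to
a multiple of the polytabloid of weight `m`. -/
noncomputable def spechtMap (m : ℕ) :
    irrep n x →ₗ[MonoidAlgebra ℂ (Equiv.Perm (Fin n))] (permAction n).asModule :=
  (LinearMap.toSpanSingleton _ _
    ((permAction n).asModuleEquiv.symm (secondRowVector hx m))).comp (irrep n x).subtype

/-- `spechtMap` as a complex linear map. -/
noncomputable def spechtHom (m : ℕ) : irrep n x →ₗ[ℂ] Qubits n :=
  (permAction n).asModuleEquiv.toLinearMap ∘ₗ (spechtMap hx m).restrictScalars ℂ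

theorem spechtHom_apply (m : ℕ) (z : irrep n x) :
    spechtHom hx m z = (permAction n).asAlgebraHom z (secondRowVector hx m) := rfl

theorem spechtHom_smul (m : ℕ) (a : MonoidAlgebra ℂ (Equiv.Perm (Fin n))) (z : irrep n x) :
    spechtHom hx m (a • z) = (permAction n).asAlgebraHom a (spechtHom hx m z) := by
  rw [spechtHom_apply, spechtHom_apply, ← Module.End.mul_apply, ← map_mul]
  rfl

theorem spechtHom_irrepGenerator (m : ℕ) :
    spechtHom hx m (irrepGenerator n x) = (#(rowGroup n x) : ℂ) • polytabloid hx m :=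
  youngSymmetrizer_secondRowVector hx m

theorem polytabloid_mem_range (m : ℕ) : polytabloid hx m ∈ LinearMap.range (spechtHom hx m) := by
  refine ⟨(#(rowGroup n x) : ℂ)⁻¹ • irrepGenerator n x, ?_⟩
  rw [map_smul, spechtHom_irrepGenerator, smul_smul, inv_mul_cancel₀ card_rowGroup_ne_zero,
    one_smul]

theorem permAction_mem_range (m : ℕ) (g : Equiv.Perm (Fin n)) {u : Qubits n}
    (hu : u ∈ LinearMap.range (spechtHom hx m)) :
    permAction n g u ∈ LinearMap.range (spechtHom hx m) := by
  obtain ⟨z, rfl⟩ := hu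
  exact ⟨MonoidAlgebra.of ℂ _ g • z, by rw [spechtHom_smul, Representation.asAlgebraHom_of]⟩

theorem range_spechtHom_le (m : ℕ) {P : Submodule ℂ (Qubits n)}
    (hP : ∀ g, ∀ v ∈ P, permAction n g v ∈ P) (hm : polytabloid hx m ∈ P) :
    LinearMap.range (spechtHom hx m) ≤ P := by
  rintro _ ⟨z, rfl⟩
  obtain ⟨a, rfl⟩ := exists_smul_irrepGenerator z
  rw [spechtHom_smul, spechtHom_irrepGenerator]
  exact asAlgebraHom_mem hP a (P.smul_mem _ hm)

theorem range_spechtHom_apply_eq_zero {m : ℕ} {u : Qubits n}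
    (hu : u ∈ LinearMap.range (spechtHom hx m)) {w : Fin n → Fin 2} (hw : weight w ≠ m) :
    u w = 0 := by
  let P : Submodule ℂ (Qubits n) :=
    { carrier := {u | ∀ w, weight w ≠ m → u w = 0}
      zero_mem' := fun _ _ => rfl
      add_mem' := fun {a b} ha hb w hw => by rw [PiLp.add_apply, ha w hw, hb w hw, add_zero]
      smul_mem' := fun c a ha w hw => by rw [PiLp.smul_apply, ha w hw, smul_zero] }
  refine range_spechtHom_le hx m (P := P) (fun g v hv w hw => ?_) (fun w hw => ?_) hu w hw
  · exact hv (w ∘ g) (by rwa [weight_comp])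
  · rw [polytabloid_apply, if_neg hw]

theorem inner_permAction (g : Equiv.Perm (Fin n)) (a b : Qubits n) :
    inner ℂ (permAction n g a) (permAction n g b) = inner ℂ a b := by
  rw [PiLp.inner_apply, PiLp.inner_apply]
  exact Fintype.sum_equiv (g.symm.arrowCongr (Equiv.refl _)) _ _ fun w => rfl

/-- The word of weight `x` that is `1` exactly on the second row. -/
def secondRowWord (n x : ℕ) : Fin n → Fin 2 := fun j => if n - x ≤ (j : ℕ) then 1 else 0

theorem secondRowWord_eq_normalizedWord : secondRowWord n x = normalizedWord n x x := by
  funext j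
  rw [secondRowWord, normalizedWord]
  exact if_congr (by omega) rfl rfl

include hx in
theorem weight_secondRowWord : weight (secondRowWord n x) = x := by
  rw [secondRowWord_eq_normalizedWord]
  exact weight_normalizedWord le_rfl (by omega)

theorem eq_secondRowWord {w : Fin n → Fin 2} (hw : weight w = x)
    (hb : ∀ s, w (botBox hx s) = 1) : w = secondRowWord n x := by
  have h : univ.filter (fun j => secondRowWord n x j = 1) = univ.filter (fun j => w j = 1) := by
    refine eq_of_subset_of_card_le (fun j hj => ?_) ?_
    · rw [mem_filter_univ, secondRowWord] at hj
      split_ifs at hj with hj'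
      · obtain ⟨s, rfl⟩ := eq_botBox hx hj'
        rw [mem_filter_univ]
        exact hb s
      · simp at hj
    · change weight w ≤ weight (secondRowWord n x)
      rw [hw, weight_secondRowWord hx]
  funext j
  have := Finset.ext_iff.1 h j
  simp only [mem_filter_univ] at this
  omega

theorem secondRowVector_self : secondRowVector hx x =
    EuclideanSpace.single (secondRowWord n x) (1 : ℂ) := by
  ext w
  rw [secondRowVector_apply, PiLp.single_apply]
  refine if_congr ⟨fun h => eq_secondRowWord hx h.1 h.2, ?_⟩ rfl rfl
  rintro rfl
  refine ⟨weight_secondRowWord hx, fun s => ?_⟩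
  rw [secondRowWord, if_pos (by rw [botBox_val]; omega)]

theorem secondRowWord_comp_eq_iff {h : Equiv.Perm (Fin n)} :
    secondRowWord n x ∘ h = secondRowWord n x ↔ h ∈ rowGroup n x := by
  rw [mem_rowGroup, funext_iff]
  refine forall_congr' fun j => ?_
  simp only [Function.comp_apply, secondRowWord]
  split_ifs <;> simp [*]

theorem spechtHom_self_injective : Function.Injective (spechtHom hx x) := by
  rw [injective_iff_map_eq_zero]
  intro z hz
  ext g
  have h := congrArg (fun v : Qubits n => v (secondRowWord n x ∘ g.symm)) hz
  simp only [spechtHom_apply, asAlgebraHom_apply] at h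
  rw [secondRowVector_self, ← Equiv.sum_comp (Equiv.mulLeft g)] at h
  simp only [PiLp.single_apply, Equiv.coe_mulLeft] at h
  have e (k : Equiv.Perm (Fin n)) :
      (secondRowWord n x ∘ g.symm) ∘ (g * k : Equiv.Perm (Fin n)) = secondRowWord n x ∘ k := by
    funext j
    simp
  simp only [e, secondRowWord_comp_eq_iff, mul_ite, mul_one, mul_zero] at h
  rw [← sum_filter, sum_congr rfl fun k hk => coeff_mul_of_mem_rowGroup z (by simpa using hk) g,
    filter_univ_mem, sum_const, nsmul_eq_mul] at h
  exact (mul_eq_zero.1 h).resolve_left card_rowGroup_ne_zero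

/-- The column sum maps the words of weight `x` to multiples of the polytabloid. -/
theorem columnSum_apply_eq_smul {u : Qubits n} (hu : ∀ w, weight w ≠ x → u w = 0) :
    (permAction n).asAlgebraHom (columnSum n x) u =
      (permAction n).asAlgebraHom (columnSum n x) u (secondRowWord n x) • polytabloid hx x := by
  rw [← sub_eq_zero]
  ext w
  refine eq_zero_of_antisymmetric hx (fun w => ((permAction n).asAlgebraHom (columnSum n x) u -
    (permAction n).asAlgebraHom (columnSum n x) u (secondRowWord n x) • polytabloid hx x) w)
    (fun s w => ?_) (fun w hw => ?_) w
  · simp only [PiLp.sub_apply, PiLp.smul_apply, columnSum_antisymmetric,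
      polytabloid_antisymmetric, smul_neg]
    ring
  · rw [PiLp.sub_apply, PiLp.smul_apply, polytabloid_apply_of_isNormalized hx hw]
    by_cases h : weight w = x
    · rw [if_pos h, eq_secondRowWord hx h fun s => (hw s).1]
      simp
    · rw [if_neg h, columnSum_apply, sum_eq_zero]
      · simp
      · intro c _
        rw [hu _ (by rwa [weight_comp]), mul_zero]

/-- The key to James' submodule theorem: a nonzero vector of the module generated by the polytabloid
is not orthogonal to all translates of the polytabloid, so some translate of it has a nonzero
column sum. -/
theorem exists_columnSum_ne_zero {u : Qubits n} (hu : u ∈ LinearMap.range (spechtHom hx x))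
    (h0 : u ≠ 0) : ∃ g, (permAction n).asAlgebraHom (columnSum n x) (permAction n g u)
      (secondRowWord n x) ≠ 0 := by
  by_contra! hcon
  let P : Submodule ℂ (Qubits n) :=
    { carrier := {v | ∀ g, inner ℂ u (permAction n g v) = 0}
      zero_mem' := fun g => by rw [map_zero, inner_zero_right]
      add_mem' := fun {a b} ha hb g => by rw [map_add, inner_add_right, ha g, hb g, add_zero]
      smul_mem' := fun c a ha g => by rw [map_smul, inner_smul_right, ha g, mul_zero] }
  have hP : u ∈ P := by
    refine range_spechtHom_le hx x (P := P) (fun g v hv k => ?_) (fun g => ?_) hu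
    · rw [← Module.End.mul_apply, ← map_mul]
      exact hv (k * g)
    · have h := congrArg (starRingEnd ℂ) (hcon g⁻¹)
      rw [columnSum_apply, map_sum, map_zero] at h
      rw [← columnSum_secondRowVector, secondRowVector_self, columnSum, map_sum,
        LinearMap.sum_apply, map_sum, inner_sum, ← h]
      refine sum_bij' (fun c _ => c⁻¹) (fun c _ => c⁻¹) (fun c hc => inv_mem_columnGroup hc)
        (fun c hc => inv_mem_columnGroup hc) (fun c _ => inv_inv c) (fun c _ => inv_inv c) ?_
      intro c _
      rw [Representation.asAlgebraHom_single, LinearMap.smul_apply, map_smul, inner_smul_right,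
        permAction_single, permAction_single, EuclideanSpace.inner_single_right, one_mul, map_mul,
        Equiv.Perm.sign_inv, permAction_apply]
      congr 1
      simp
  have := hP 1
  rw [map_one, Module.End.one_apply, inner_self_eq_zero] at this
  exact h0 this

include hx in
theorem isSimpleModule_irrep :
    IsSimpleModule (MonoidAlgebra ℂ (Equiv.Perm (Fin n))) (irrep n x) := by
  rw [isSimpleModule_iff_toSpanSingleton_surjective]
  constructor
  · refine ⟨⟨irrepGenerator n x, 0, fun h => ?_⟩⟩
    have h1 := congrArg (fun z => spechtHom hx x z (normalizedWord n x x)) h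
    simp only [spechtHom_irrepGenerator, map_zero, PiLp.smul_apply, PiLp.zero_apply] at h1
    rw [polytabloid_apply_of_isNormalized hx (isNormalized_normalizedWord hx),
      if_pos (weight_normalizedWord le_rfl (by omega)), smul_eq_mul, mul_one] at h1
    exact card_rowGroup_ne_zero h1
  · intro z hz y
    have hu0 : spechtHom hx x z ≠ 0 := fun h =>
      hz (spechtHom_self_injective hx (by rw [h, map_zero]))
    obtain ⟨g, hg⟩ := exists_columnSum_ne_zero hx ⟨z, rfl⟩ hu0
    set c := (permAction n).asAlgebraHom (columnSum n x) (permAction n g (spechtHom hx x z))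
      (secondRowWord n x) with hc
    have key : columnSum n x • MonoidAlgebra.of ℂ _ g • z =
        (c * (#(rowGroup n x) : ℂ)⁻¹) • irrepGenerator n x := by
      apply spechtHom_self_injective hx
      rw [spechtHom_smul, spechtHom_smul, Representation.asAlgebraHom_of, map_smul,
        spechtHom_irrepGenerator, columnSum_apply_eq_smul hx, ← hc, smul_smul, mul_assoc,
        inv_mul_cancel₀ card_rowGroup_ne_zero, mul_one]
      exact fun w hw => range_spechtHom_apply_eq_zero hx
        (permAction_mem_range hx x g ⟨z, rfl⟩) hw
    obtain ⟨a, rfl⟩ := exists_smul_irrepGenerator y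
    have hcr : c * (#(rowGroup n x) : ℂ)⁻¹ ≠ 0 := mul_ne_zero hg (inv_ne_zero card_rowGroup_ne_zero)
    refine ⟨((c * (#(rowGroup n x) : ℂ)⁻¹)⁻¹ • a) * (columnSum n x * MonoidAlgebra.of ℂ _ g), ?_⟩
    rw [LinearMap.toSpanSingleton_apply, mul_smul, mul_smul, key, smul_comm, smul_assoc, smul_smul,
      mul_inv_cancel₀ hcr, one_smul]

theorem spechtMap_injective {m : ℕ} (h1 : x ≤ m) (h2 : m ≤ n - x) :
    Function.Injective (spechtMap hx m) := by
  have := isSimpleModule_irrep hx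
  refine LinearMap.injective_of_ne_zero fun h => ?_
  have h3 : spechtHom hx m (irrepGenerator n x) (normalizedWord n x m) = 0 := by
    rw [spechtHom, h]
    rfl
  rw [spechtHom_irrepGenerator, PiLp.smul_apply,
    polytabloid_apply_of_isNormalized hx (isNormalized_normalizedWord hx),
    if_pos (weight_normalizedWord h1 h2), smul_eq_mul, mul_one] at h3
  exact card_rowGroup_ne_zero h3

theorem spechtHom_injective {m : ℕ} (h1 : x ≤ m) (h2 : m ≤ n - x) :
    Function.Injective (spechtHom hx m) :=
  (permAction n).asModuleEquiv.injective.comp (spechtMap_injective hx h1 h2)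

theorem range_spechtHom_le_isotypicSubspace {m : ℕ} (h1 : x ≤ m) (h2 : m ≤ n - x) :
    LinearMap.range (spechtHom hx m) ≤ isotypicSubspace n x := by
  rintro _ ⟨z, rfl⟩
  refine ⟨spechtMap hx m z, ?_, rfl⟩
  have : LinearMap.range (spechtMap hx m) ≤ isotypicComponent
      (MonoidAlgebra ℂ (Equiv.Perm (Fin n))) (permAction n).asModule (irrep n x) :=
    le_sSup ⟨(LinearEquiv.ofInjective _ (spechtMap_injective hx h1 h2)).symm⟩
  exact this ⟨z, rfl⟩

/-- Every homomorphism from the Specht module extends to the group algebra, so is `z ↦ z • u`, and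
the image of the Young symmetrizer is a combination of polytabloids. -/
theorem isotypicSubspace_le {P : Submodule ℂ (Qubits n)}
    (hP : ∀ m, LinearMap.range (spechtHom hx m) ≤ P) : isotypicSubspace n x ≤ P := by
  have key : isotypicComponent (MonoidAlgebra ℂ (Equiv.Perm (Fin n))) (permAction n).asModule
      (irrep n x) ≤ ⨆ m, LinearMap.range (spechtMap hx m) := by
    refine sSup_le ?_
    rintro N ⟨e⟩ y hy
    let ψ := N.subtype ∘ₗ e.symm.toLinearMap
    have hψ : ψ (e ⟨y, hy⟩) = y := by simp [ψ]
    have : NeZero ((Nat.card (Equiv.Perm (Fin n)) : ℕ) : ℂ) :=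
      ⟨by exact_mod_cast Nat.card_pos.ne'⟩
    obtain ⟨π, hπ⟩ := MonoidAlgebra.exists_leftInverse_of_injective (k := ℂ)
      (G := Equiv.Perm (Fin n)) (irrep n x).subtype (Submodule.ker_subtype _)
    have hmul (z : irrep n x) : ψ z = (z : MonoidAlgebra ℂ (Equiv.Perm (Fin n))) • ψ (π 1) := by
      rw [← map_smul, ← map_smul, smul_eq_mul, mul_one]
      exact congrArg ψ (LinearMap.congr_fun hπ z).symm
    obtain ⟨a, ha⟩ := exists_smul_irrepGenerator (e ⟨y, hy⟩)
    rw [← hψ, ← ha, map_smul]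
    refine Submodule.smul_mem _ _ ?_
    rw [hmul]
    obtain ⟨c, hc⟩ := youngSymmetrizer_apply_eq_sum hx
      ((permAction n).asModuleEquiv (ψ (π 1)))
    have hc' : ((irrepGenerator n x : irrep n x) : MonoidAlgebra ℂ (Equiv.Perm (Fin n))) •
        ψ (π 1) = ∑ m ∈ range (n + 1), c m • (permAction n).asModuleEquiv.symm
          (polytabloid hx m) := by
      apply (permAction n).asModuleEquiv.injective
      rw [Representation.asModuleEquiv_map_smul, map_sum]
      refine hc.trans (sum_congr rfl fun m _ => ?_)
      rw [map_smul, LinearEquiv.apply_symm_apply]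
    rw [hc']
    refine Submodule.sum_mem _ fun m _ => ?_
    obtain ⟨z, hz⟩ := polytabloid_mem_range hx m
    refine Submodule.mem_iSup_of_mem m ⟨c m • z, ?_⟩
    apply (permAction n).asModuleEquiv.injective
    change spechtHom hx m (c m • z) = _
    rw [map_smul, hz, map_smul, LinearEquiv.apply_symm_apply]
  have mem (y : (permAction n).asModule) (hy : y ∈ ⨆ m, LinearMap.range (spechtMap hx m)) :
      (permAction n).asModuleEquiv y ∈ P := by
    induction hy using Submodule.iSup_induction' with
    | mem m y hm =>
      obtain ⟨z, rfl⟩ := hm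
      exact hP m ⟨z, rfl⟩
    | zero => rw [map_zero]; exact P.zero_mem
    | add a b _ _ ha hb => rw [map_add]; exact P.add_mem ha hb
  rintro _ ⟨y, hy, rfl⟩
  exact mem y (key hy)

end Specht

/-! ### Distance operators -/

section Zonal

variable {n x : ℕ}

/-- The distance-`i` operator of the Johnson scheme: the sum of the values on a sphere. -/
noncomputable def sphereOperator (n i : ℕ) : Qubits n →ₗ[ℂ] Qubits n where
  toFun u := WithLp.toLp 2 fun w => ∑ w' ∈ sphere w i, u w'
  map_add' u v := by
    ext w
    simp [sum_add_distrib]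
  map_smul' c u := by
    ext w
    simp [mul_sum]

theorem sphereOperator_apply (i : ℕ) (u : Qubits n) (w : Fin n → Fin 2) :
    sphereOperator n i u w = ∑ w' ∈ sphere w i, u w' := rfl

theorem sphereOperator_comp (i : ℕ) (u : Qubits n) (g : Equiv.Perm (Fin n)) (w : Fin n → Fin 2) :
    sphereOperator n i u (w ∘ g) = ∑ w' ∈ sphere w i, u (w' ∘ g) := by
  rw [sphereOperator_apply]
  refine (sum_equiv (g.symm.arrowCongr (Equiv.refl _)) (fun w' => ?_) fun w' _ => rfl).symm
  rw [mem_sphere, mem_sphere]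
  change _ ↔ weight (w' ∘ g) = _ ∧ wordDist (w ∘ g) (w' ∘ g) = i
  rw [weight_comp, weight_comp, wordDist_comp]

theorem sphereOperator_permAction (i : ℕ) (g : Equiv.Perm (Fin n)) (u : Qubits n) :
    sphereOperator n i (permAction n g u) = permAction n g (sphereOperator n i u) := by
  ext w
  rw [permAction_apply, sphereOperator_comp]
  rfl

variable (hx : 2 * x ≤ n)

/-- Polytabloids are eigenvectors of the distance operators. -/
theorem sphereOperator_polytabloid (m i : ℕ) : sphereOperator n i (polytabloid hx m) =
    eberlein x (m - x) (n - m - x) i • polytabloid hx m := by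
  rw [← sub_eq_zero]
  ext w
  refine eq_zero_of_antisymmetric hx (fun w => (sphereOperator n i (polytabloid hx m) -
    eberlein x (m - x) (n - m - x) i • polytabloid hx m) w) (fun s w => ?_) (fun w hw => ?_) w
  · simp only [PiLp.sub_apply, PiLp.smul_apply]
    rw [sphereOperator_comp, sum_congr rfl fun w' _ => polytabloid_antisymmetric hx m s w',
      sum_neg_distrib, ← sphereOperator_apply, polytabloid_antisymmetric, smul_neg]
    ring
  · rw [PiLp.sub_apply, PiLp.smul_apply, polytabloid_apply_of_isNormalized hx hw,
      sphereOperator_apply]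
    by_cases h : weight w = m
    · rw [if_pos h, sub_eq_zero, sum_congr rfl fun w' hw' => by
        rw [polytabloid_apply, if_pos ((mem_sphere.1 hw').1.trans h)], sum_sphere]
      set B := univ.filter (fun j => w j = 1) \ univ.image (botBox hx) with hB
      set C := univ.filter (fun j => w j = 0) \ univ.image (topBox hx) with hC
      have hbot : univ.image (botBox hx) ⊆ univ.filter (fun j => w j = 1) := fun j hj => by
        obtain ⟨s, -, rfl⟩ := mem_image.1 hj
        simpa using (hw s).1
      have htop : univ.image (topBox hx) ⊆ univ.filter (fun j => w j = 0) := fun j hj => by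
        obtain ⟨s, -, rfl⟩ := mem_image.1 hj
        simpa using (hw s).2
      have cB : #B = m - x := by
        rw [hB, card_sdiff_of_subset hbot, card_image_of_injective _ (botBox_injective hx),
          card_univ, Fintype.card_fin, ← h, weight]
      have cC : #C = n - m - x := by
        rw [hC, card_sdiff_of_subset htop, card_image_of_injective _ (topBox_injective hx),
          card_univ, Fintype.card_fin, card_zeros, h, Fintype.card_fin]
      have key := sum_powersetCard_prod_pairs (topBox hx) (botBox hx) (topBox_injective hx)
        (botBox_injective hx) B C (fun s => by simp [hB]) (fun s => by simp [hC]) univ i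
      rw [cB, cC, card_univ, Fintype.card_fin, hB, hC, sdiff_union_of_subset hbot,
        sdiff_union_of_subset htop] at key
      rw [smul_eq_mul, mul_one, ← key]
      refine sum_congr rfl fun R hR => sum_congr rfl fun S hS => prod_congr rfl fun s _ => ?_
      have h1 : topBox hx s ∉ R := fun hs => by
        have := (mem_powersetCard.1 hR).1 hs
        rw [mem_filter_univ, (hw s).2] at this
        exact absurd this (by decide)
      have h2 : botBox hx s ∉ S := fun hs => by
        have := (mem_powersetCard.1 hS).1 hs
        rw [mem_filter_univ, (hw s).1] at this
        exact absurd this (by decide)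
      simp only [exchange, if_neg h1, if_neg h2, (hw s).1, (hw s).2]
      split_ifs <;> simp
    · rw [if_neg h, smul_zero, sub_zero]
      refine sum_eq_zero fun w' hw' => ?_
      rw [polytabloid_apply, if_neg]
      rw [(mem_sphere.1 hw').1]
      exact h

theorem sphereOperator_eq_smul {m : ℕ} (i : ℕ) {u : Qubits n}
    (hu : u ∈ LinearMap.range (spechtHom hx m)) :
    sphereOperator n i u = eberlein x (m - x) (n - m - x) i • u := by
  rw [← sub_eq_zero]
  refine range_spechtHom_le hx m (P := LinearMap.ker (sphereOperator n i -
    eberlein x (m - x) (n - m - x) i • LinearMap.id)) (fun g v hv => ?_) ?_ hu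
  · have hv' := sub_eq_zero.1 (LinearMap.mem_ker.1 hv)
    rw [LinearMap.mem_ker, LinearMap.sub_apply, sphereOperator_permAction, hv']
    simp
  · rw [LinearMap.mem_ker, LinearMap.sub_apply, sphereOperator_polytabloid]
    simp

/-! ### Zonal vectors -/

/-- The zonal vector with base word `w₀`: its value at a word of the same weight is the zonal
spherical function at the distance from `w₀`. -/
noncomputable def zonalVector (n x : ℕ) (w₀ : Fin n → Fin 2) : Qubits n := WithLp.toLp 2 fun w =>
  if weight w = weight w₀ then omega n (weight w₀) x (wordDist w₀ w) else 0

theorem zonalVector_apply (w₀ w : Fin n → Fin 2) : zonalVector n x w₀ w =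
    if weight w = weight w₀ then omega n (weight w₀) x (wordDist w₀ w) else 0 := rfl

theorem omega_zero_right (n m x : ℕ) : omega n m x 0 = 1 := by
  rw [omega_eq_eberlein, eberlein_zero_right]
  simp

theorem zonalVector_self (w₀ : Fin n → Fin 2) : zonalVector n x w₀ w₀ = 1 := by
  rw [zonalVector_apply, if_pos rfl, wordDist_self, omega_zero_right]

/-- A vector of the Specht copy fixed by the stabilizer of a word `w₀` is constant on the spheres
about `w₀`, hence by the eigenvalue equation at `w₀` a multiple of the zonal vector. -/
theorem eq_smul_zonalVector {w₀ : Fin n → Fin 2} {u : Qubits n}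
    (hu : u ∈ LinearMap.range (spechtHom hx (weight w₀)))
    (hfix : ∀ g : Equiv.Perm (Fin n), w₀ ∘ g = w₀ → permAction n g u = u) :
    u = u w₀ • zonalVector n x w₀ := by
  ext w
  rw [PiLp.smul_apply, zonalVector_apply]
  split_ifs with hw
  · have hs := congrArg (fun v : Qubits n => v w₀) (sphereOperator_eq_smul hx (wordDist w₀ w) hu)
    simp only [PiLp.smul_apply, sphereOperator_apply, smul_eq_mul] at hs
    rw [sum_congr rfl (g := fun _ => u w) fun w' hw' => ?_, sum_const, card_sphere,
      Fintype.card_fin, nsmul_eq_mul] at hs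
    · have hne : (((weight w₀).choose (wordDist w₀ w) *
          (n - weight w₀).choose (wordDist w₀ w) : ℕ) : ℂ) ≠ 0 := by
        have hc := card_sphere w₀ (wordDist w₀ w)
        rw [Fintype.card_fin] at hc
        rw [← hc]
        exact_mod_cast (card_pos.2 ⟨w, mem_sphere.2 ⟨hw, rfl⟩⟩).ne'
      push_cast at hs hne
      obtain ⟨hne1, hne2⟩ := mul_ne_zero_iff.1 hne
      rw [omega_eq_eberlein, smul_eq_mul]
      field_simp
      linear_combination hs
    · obtain ⟨h1, h2⟩ := mem_sphere.1 hw'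
      obtain ⟨g, hg0, hg⟩ := exists_perm_of_wordDist_eq (w₀ := w₀) (w := w) (w' := w')
        (hw.trans h1.symm) h2.symm
      rw [← hg]
      exact congrArg (fun v : Qubits n => v w) (hfix g hg0)
  · rw [smul_zero]
    exact range_spechtHom_apply_eq_zero hx hu hw

/-- The stabilizer of a word. -/
def wordStabilizer (w₀ : Fin n → Fin 2) : Finset (Equiv.Perm (Fin n)) := {g | w₀ ∘ g = w₀}

theorem mem_wordStabilizer {w₀ : Fin n → Fin 2} {g : Equiv.Perm (Fin n)} :
    g ∈ wordStabilizer w₀ ↔ w₀ ∘ g = w₀ := by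
  simp [wordStabilizer]

theorem mul_mem_wordStabilizer_iff {w₀ : Fin n → Fin 2} {g h : Equiv.Perm (Fin n)}
    (hg : g ∈ wordStabilizer w₀) : g * h ∈ wordStabilizer w₀ ↔ h ∈ wordStabilizer w₀ := by
  rw [mem_wordStabilizer] at *
  rw [mem_wordStabilizer, Equiv.Perm.coe_mul, ← Function.comp_assoc, hg]

theorem card_wordStabilizer_ne_zero (w₀ : Fin n → Fin 2) : (#(wordStabilizer w₀) : ℂ) ≠ 0 := by
  have : (1 : Equiv.Perm (Fin n)) ∈ wordStabilizer w₀ := mem_wordStabilizer.2 rfl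
  exact_mod_cast (card_pos.2 ⟨1, this⟩).ne'

/-- Summing over the stabilizer of `w₀` projects a Specht copy onto the line of the zonal
vector. -/
theorem sum_wordStabilizer {w₀ : Fin n → Fin 2} {u : Qubits n}
    (hu : u ∈ LinearMap.range (spechtHom hx (weight w₀))) :
    ∑ g ∈ wordStabilizer w₀, permAction n g u =
      ((#(wordStabilizer w₀) : ℂ) * u w₀) • zonalVector n x w₀ := by
  rw [eq_smul_zonalVector hx (w₀ := w₀) (u := ∑ g ∈ wordStabilizer w₀, permAction n g u)]
  · congr 1
    rw [WithLp.ofLp_sum, Finset.sum_apply, sum_congr rfl (g := fun _ => u w₀)]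
    · simp
    · intro g hg
      rw [permAction_apply, mem_wordStabilizer.1 hg]
  · exact Submodule.sum_mem _ fun g _ => permAction_mem_range hx _ g hu
  · intro h hh
    rw [map_sum]
    refine sum_equiv (Equiv.mulLeft h)
      (fun g => (mul_mem_wordStabilizer_iff (mem_wordStabilizer.2 hh)).symm) fun g _ => ?_
    rw [Equiv.coe_mulLeft, map_mul, Module.End.mul_apply]

theorem zonalVector_mem_range {w₀ : Fin n → Fin 2} (h1 : x ≤ weight w₀)
    (h2 : weight w₀ ≤ n - x) :
    zonalVector n x w₀ ∈ LinearMap.range (spechtHom hx (weight w₀)) := by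
  obtain ⟨g, hg⟩ := exists_perm_of_weight_eq (w := w₀) (w' := normalizedWord n x (weight w₀))
    (weight_normalizedWord h1 h2).symm
  have hu := permAction_mem_range hx (weight w₀) g (polytabloid_mem_range hx (weight w₀))
  have h0 : permAction n g (polytabloid hx (weight w₀)) w₀ = 1 := by
    rw [permAction_apply, hg,
      polytabloid_apply_of_isNormalized hx (isNormalized_normalizedWord hx),
      if_pos (weight_normalizedWord h1 h2)]
  have hs := sum_wordStabilizer hx hu
  rw [h0, mul_one] at hs
  rw [← inv_smul_smul₀ (card_wordStabilizer_ne_zero w₀) (zonalVector n x w₀), ← hs]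
  exact Submodule.smul_mem _ _ (Submodule.sum_mem _ fun k _ => permAction_mem_range hx _ k hu)

theorem permAction_zonalVector {w₀ : Fin n → Fin 2} {g : Equiv.Perm (Fin n)}
    (hg : w₀ ∘ g = w₀) : permAction n g (zonalVector n x w₀) = zonalVector n x w₀ := by
  ext w
  rw [permAction_apply, zonalVector_apply, zonalVector_apply, weight_comp]
  have := wordDist_comp w₀ w g
  rw [hg] at this
  rw [this]

/-- The zonal vector is a reproducing kernel of the Specht copy. -/
theorem inner_zonalVector {w₀ : Fin n → Fin 2} {u : Qubits n}
    (hu : u ∈ LinearMap.range (spechtHom hx (weight w₀))) :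
    inner ℂ (zonalVector n x w₀) u =
      inner ℂ (zonalVector n x w₀) (zonalVector n x w₀) * u w₀ := by
  have h := congrArg (inner ℂ (zonalVector n x w₀)) (sum_wordStabilizer hx hu)
  rw [inner_sum, inner_smul_right, sum_congr rfl (g := fun _ => inner ℂ (zonalVector n x w₀) u),
    sum_const, nsmul_eq_mul, mul_assoc] at h
  · rw [mul_left_cancel₀ (card_wordStabilizer_ne_zero w₀) h, mul_comm]
  · intro g hg
    conv_lhs => rw [← permAction_zonalVector (mem_wordStabilizer.1 hg)]
    rw [inner_permAction]

/-- The squared norm of the zonal vectors with a base word of weight `m`. -/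
noncomputable def zonalNormSq (n m x : ℕ) : ℂ :=
  ∑ i ∈ range (m + 1), (m.choose i : ℂ) * ((n - m).choose i : ℂ) *
    (omega n m x i * (starRingEnd ℂ) (omega n m x i))

theorem inner_zonalVector_self (w₀ : Fin n → Fin 2) :
    inner ℂ (zonalVector n x w₀) (zonalVector n x w₀) = zonalNormSq n (weight w₀) x := by
  rw [PiLp.inner_apply, zonalNormSq]
  simp only [RCLike.inner_apply, zonalVector_apply]
  have h (w : Fin n → Fin 2) :
      ((if weight w = weight w₀ then omega n (weight w₀) x (wordDist w₀ w) else 0) *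
        (starRingEnd ℂ) (if weight w = weight w₀ then omega n (weight w₀) x (wordDist w₀ w)
          else 0)) = if weight w = weight w₀ then omega n (weight w₀) x (wordDist w₀ w) *
            (starRingEnd ℂ) (omega n (weight w₀) x (wordDist w₀ w)) else 0 := by
    split_ifs <;> simp
  rw [sum_congr rfl fun w _ => h w, ← sum_filter,
    ← sum_fiberwise_of_maps_to (t := range (weight w₀ + 1)) (g := wordDist w₀)]
  · refine sum_congr rfl fun i _ => ?_
    rw [filter_filter]
    have hc := card_sphere w₀ i
    rw [Fintype.card_fin] at hc
    rw [sum_congr rfl (g := fun _ => omega n (weight w₀) x i *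
      (starRingEnd ℂ) (omega n (weight w₀) x i)), sum_const]
    · change #(sphere w₀ i) • _ = _
      rw [hc, nsmul_eq_mul]
      push_cast
      ring
    · intro w hw
      rw [(mem_filter.1 hw).2.2]
  · intro w _
    exact mem_range.2 (Nat.lt_succ_of_le (wordDist_le_weight _ _))

theorem zonalNormSq_ne_zero (w₀ : Fin n → Fin 2) : zonalNormSq n (weight w₀) x ≠ 0 := by
  rw [← inner_zonalVector_self, Ne, inner_self_eq_zero]
  intro h
  have := zonalVector_self (x := x) w₀
  rw [h] at this
  simp at this

theorem inner_single_sub_zonalVector {w₀ : Fin n → Fin 2} {m : ℕ} {u : Qubits n}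
    (hu : u ∈ LinearMap.range (spechtHom hx m)) :
    inner ℂ (EuclideanSpace.single w₀ (1 : ℂ) -
      (zonalNormSq n (weight w₀) x)⁻¹ • zonalVector n x w₀) u = 0 := by
  by_cases hm : m = weight w₀
  · subst hm
    have hreal : (starRingEnd ℂ) (zonalNormSq n (weight w₀) x) = zonalNormSq n (weight w₀) x := by
      rw [← inner_zonalVector_self, inner_conj_symm]
    rw [inner_sub_left, inner_smul_left, inner_zonalVector hx hu, inner_zonalVector_self,
      EuclideanSpace.inner_single_left, map_inv₀, hreal, map_one, one_mul,
      inv_mul_cancel_left₀ (zonalNormSq_ne_zero w₀), sub_self]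
  · rw [PiLp.inner_apply]
    refine sum_eq_zero fun w _ => ?_
    by_cases hw : weight w = m
    · have hne : weight w ≠ weight w₀ := hw ▸ hm
      rw [PiLp.sub_apply, PiLp.smul_apply, zonalVector_apply, if_neg hne, PiLp.single_apply,
        if_neg (fun h => hne (congrArg weight h))]
      simp
    · rw [range_spechtHom_apply_eq_zero hx hu hw, inner_zero_right]

include hx in
/-- The projection of a word onto the isotypic component. -/
theorem isotypicProjector_single {w₀ : Fin n → Fin 2} (h1 : x ≤ weight w₀)
    (h2 : weight w₀ ≤ n - x) :
    isotypicProjector n x (EuclideanSpace.single w₀ (1 : ℂ)) =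
      (zonalNormSq n (weight w₀) x)⁻¹ • zonalVector n x w₀ := by
  refine Submodule.eq_starProjection_of_mem_of_inner_eq_zero (Submodule.smul_mem _ _
    (range_spechtHom_le_isotypicSubspace hx h1 h2 (zonalVector_mem_range hx h1 h2))) fun u hu => ?_
  have hle : isotypicSubspace n x ≤ (Submodule.span ℂ {EuclideanSpace.single w₀ (1 : ℂ) -
      (zonalNormSq n (weight w₀) x)⁻¹ • zonalVector n x w₀})ᗮ :=
    isotypicSubspace_le hx fun m v hv =>
      Submodule.mem_orthogonal_singleton_iff_inner_right.2 (inner_single_sub_zonalVector hx hv)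
  exact Submodule.mem_orthogonal_singleton_iff_inner_right.1 (hle hu)

include hx in
theorem isotypicSubspace_apply_eq_zero {u : Qubits n} (hu : u ∈ isotypicSubspace n x)
    {w : Fin n → Fin 2} (hw : weight w < x) : u w = 0 := by
  have hle : isotypicSubspace n x ≤ LinearMap.ker
      (EuclideanSpace.proj w : Qubits n →L[ℂ] ℂ).toLinearMap := by
    refine isotypicSubspace_le hx fun m v hv => ?_
    rw [LinearMap.mem_ker]
    change v w = 0
    by_cases hm : weight w = m
    · have hv0 : v ∈ (⊥ : Submodule ℂ (Qubits n)) := range_spechtHom_le hx m (by simp)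
        (by simp [polytabloid_eq_zero_of_lt hx (hm ▸ hw)]) hv
      rw [(Submodule.mem_bot ℂ).1 hv0]
      rfl
    · exact range_spechtHom_apply_eq_zero hx hv hm
  exact hle hu

/-! ### The dimension -/

/-- There are `t.choose M` words with prescribed letters outside a set of size `t` and exactly `M`
letters `1` in it. -/
theorem card_words (T : Finset (Fin n)) (p : Fin n → Fin 2) (M : ℕ) :
    #{w : Fin n → Fin 2 | (∀ j ∉ T, w j = p j) ∧ #{j ∈ T | w j = 1} = M} = (#T).choose M := by
  rw [← card_powersetCard]
  refine card_nbij' (fun w => {j ∈ T | w j = 1})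
    (fun X j => if j ∈ T then if j ∈ X then 1 else 0 else p j) ?_ ?_ ?_ ?_
  · intro w hw
    rw [mem_coe, mem_filter_univ] at hw
    rw [mem_coe, mem_powersetCard]
    exact ⟨filter_subset _ _, hw.2⟩
  · intro X hX
    rw [mem_coe, mem_powersetCard] at hX
    rw [mem_coe, mem_filter_univ]
    refine ⟨fun j hj => if_neg hj, ?_⟩
    rw [← hX.2]
    congr 1
    ext j
    rw [mem_filter]
    constructor
    · rintro ⟨h1, h2⟩
      by_contra h
      simp [h1, h] at h2
    · intro h
      have := hX.1 h
      simp [h, this]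
  · intro w hw
    rw [mem_coe, mem_filter_univ] at hw
    funext j
    by_cases hj : j ∈ T
    · rcases (by omega : w j = 1 ∨ w j = 0) with h | h <;> simp [hj, h]
    · simp [hj, hw.1 j hj]
  · intro X hX
    rw [mem_coe, mem_powersetCard] at hX
    ext j
    simp only [mem_filter]
    constructor
    · rintro ⟨h1, h2⟩
      by_contra h
      simp [h1, h] at h2
    · intro h
      have := hX.1 h
      simp [h, this]

theorem card_weight_eq (n m : ℕ) : #{w : Fin n → Fin 2 | weight w = m} = n.choose m := by
  have := card_words (univ : Finset (Fin n)) 0 m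
  rw [card_univ, Fintype.card_fin] at this
  rw [← this]
  congr 1
  ext w
  rw [mem_filter_univ, mem_filter_univ]
  simp [weight]

include hx in
/-- The dimension of the Specht module, as the trace of the projection onto its copy of
weight `m`. -/
theorem finrank_irrep_mul_zonalNormSq {m : ℕ} (h1 : x ≤ m) (h2 : m ≤ n - x) :
    (Module.finrank ℂ (irrep n x) : ℂ) * zonalNormSq n m x = n.choose m := by
  set W := LinearMap.range (spechtHom hx m)
  have hne : zonalNormSq n m x ≠ 0 := by
    rw [← weight_normalizedWord h1 h2]
    exact zonalNormSq_ne_zero _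
  have hproj (w : Fin n → Fin 2) : W.starProjection (EuclideanSpace.single w (1 : ℂ)) =
      if weight w = m then (zonalNormSq n m x)⁻¹ • zonalVector n x w else 0 := by
    split_ifs with hw
    · subst hw
      exact Submodule.eq_starProjection_of_mem_of_inner_eq_zero
        (Submodule.smul_mem _ _ (zonalVector_mem_range hx h1 h2))
        fun u hu => inner_single_sub_zonalVector hx hu
    · refine Submodule.eq_starProjection_of_mem_of_inner_eq_zero W.zero_mem fun u hu => ?_
      rw [sub_zero, EuclideanSpace.inner_single_left, range_spechtHom_apply_eq_zero hx hu hw,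
        mul_zero]
  have htr : LinearMap.trace ℂ (Qubits n) W.starProjection.toLinearMap =
      (Module.finrank ℂ W : ℂ) :=
    LinearMap.IsProj.trace ⟨fun v => Submodule.starProjection_apply_mem W v,
      fun v hv => Submodule.starProjection_eq_self_iff.2 hv⟩
  rw [LinearMap.trace_eq_sum_inner _ (EuclideanSpace.basisFun (Fin n → Fin 2) ℂ)] at htr
  have hterm (w : Fin n → Fin 2) : inner ℂ (EuclideanSpace.basisFun (Fin n → Fin 2) ℂ w)
      (W.starProjection.toLinearMap (EuclideanSpace.basisFun (Fin n → Fin 2) ℂ w)) =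
      if weight w = m then (zonalNormSq n m x)⁻¹ else 0 := by
    rw [EuclideanSpace.basisFun_apply]
    change inner ℂ _ (W.starProjection (EuclideanSpace.single w (1 : ℂ))) = _
    rw [hproj, EuclideanSpace.inner_single_left]
    split_ifs
    · rw [PiLp.smul_apply, zonalVector_self]
      simp
    · simp
  rw [sum_congr rfl fun w _ => hterm w, ← sum_filter, sum_const, card_weight_eq, nsmul_eq_mul]
    at htr
  rw [(LinearEquiv.ofInjective _ (spechtHom_injective hx h1 h2)).finrank_eq, ← htr,
    inv_mul_cancel_right₀ hne]

theorem eberlein_zero_middle (x b i : ℕ) : eberlein x 0 b i = (-1) ^ i * (x.choose i : ℂ) := by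
  rw [eberlein, sum_eq_single_of_mem i (by simp)]
  · simp
  · intro r hr hne
    rw [mem_range] at hr
    rw [Nat.choose_eq_zero_of_lt (n := 0) (by omega)]
    simp

include hx in
theorem zonalNormSq_self : zonalNormSq n x x = ((n : ℂ) - x + 1) / (n - 2 * x + 1) := by
  have h := sum_choose_div_choose x (n - x) (by omega)
  rw [Nat.cast_sub (by omega)] at h
  rw [show (n : ℂ) - 2 * x + 1 = n - x - x + 1 by ring, ← h, zonalNormSq]
  refine sum_congr rfl fun i hi => ?_
  rw [mem_range] at hi
  have c1 : (x.choose i : ℂ) ≠ 0 := by exact_mod_cast (Nat.choose_pos (by omega)).ne'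
  have c2 : ((n - x).choose i : ℂ) ≠ 0 := by exact_mod_cast (Nat.choose_pos (by omega)).ne'
  rw [omega_eq_eberlein, Nat.sub_self, eberlein_zero_middle]
  have s : ((-1 : ℂ) ^ i) ^ 2 = 1 := by rw [← pow_mul, mul_comm, pow_mul]; simp
  simp only [map_mul, map_inv₀, map_natCast, map_pow, map_neg, map_one]
  field_simp
  rw [s]

include hx in
theorem inv_zonalNormSq {m : ℕ} (h1 : x ≤ m) (h2 : m ≤ n - x) : (zonalNormSq n m x)⁻¹ =
    ((n.choose x : ℂ) / (n.choose m : ℂ)) * (((n : ℂ) - 2 * x + 1) / ((n : ℂ) - x + 1)) := by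
  have d0 : (n : ℂ) - x + 1 ≠ 0 := by
    rw [← Nat.cast_sub (by omega)]
    exact_mod_cast Nat.succ_ne_zero (n - x)
  have d1 : (n : ℂ) - 2 * x + 1 ≠ 0 := by
    have : ((n - 2 * x : ℕ) : ℂ) = (n : ℂ) - 2 * x := by push_cast [hx]; ring
    rw [← this]
    exact_mod_cast Nat.succ_ne_zero (n - 2 * x)
  have c0 : (n.choose m : ℂ) ≠ 0 := by exact_mod_cast (Nat.choose_pos (by omega)).ne'
  have e1 := finrank_irrep_mul_zonalNormSq hx h1 h2
  have e2 := finrank_irrep_mul_zonalNormSq hx le_rfl (show x ≤ n - x by omega)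
  rw [zonalNormSq_self hx] at e2
  have hz : zonalNormSq n m x ≠ 0 := fun h => c0 (by rw [← e1, h, mul_zero])
  rw [mul_div_assoc', div_eq_iff d1] at e2
  rw [div_mul_div_comm, ← e2, ← e1]
  have hd : (Module.finrank ℂ (irrep n x) : ℂ) ≠ 0 := fun h => c0 (by rw [← e1, h, zero_mul])
  field_simp

end Zonal

/-! ### The zonal spherical function -/

section Character

variable {n x : ℕ}

/-- The word with letter `1` exactly at the first `m` places. -/
def firstWord (n m : ℕ) : Fin n → Fin 2 := fun j => if (j : ℕ) < m then 1 else 0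

theorem firstWord_eq_one_iff {m : ℕ} {j : Fin n} :
    firstWord n m j = 1 ↔ j ∈ firstLetters n m := by
  rw [firstWord, firstLetters, mem_filter_univ]
  split_ifs <;> simp [*]

theorem weight_firstWord {m : ℕ} (hm : m ≤ n) : weight (firstWord n m) = m := by
  simp only [weight, firstWord_eq_one_iff, filter_univ_mem]
  rw [firstLetters, Fin.card_filter_val_lt]
  omega

theorem mem_youngSubgroup_iff {m : ℕ} {g : Equiv.Perm (Fin n)} :
    g ∈ youngSubgroup n m ↔ firstWord n m ∘ g = firstWord n m := by
  change (∀ j, g j ∈ firstLetters n m ↔ j ∈ firstLetters n m) ↔ _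
  simp only [funext_iff, ← firstWord_eq_one_iff, Function.comp_apply]
  exact forall_congr' fun j => by omega

theorem wordDist_firstWord {m : ℕ} (hm : m ≤ n) (g : Equiv.Perm (Fin n)) :
    wordDist (firstWord n m) (firstWord n m ∘ (g⁻¹ : Equiv.Perm (Fin n))) =
      cosetDistance n m g := by
  have h := weight_eq_add_wordDist (firstWord n m) (firstWord n m ∘ (g⁻¹ : Equiv.Perm (Fin n)))
  rw [weight_firstWord hm] at h
  have hc : #{j | firstWord n m j = 1 ∧ (firstWord n m ∘ (g⁻¹ : Equiv.Perm (Fin n))) j = 1} =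
      #(firstLetters n m ∩ (firstLetters n m).map g.toEmbedding) := by
    congr 1
    ext j
    simp only [mem_filter_univ, Function.comp_apply, firstWord_eq_one_iff, mem_inter,
      mem_map_equiv]
    rfl
  rw [cosetDistance, ← hc]
  omega

theorem zonalSpherical_irrepCharacter {m : ℕ} (hm : m ≤ n) (hx : 2 * x ≤ n) (h1 : x ≤ m)
    (h2 : m ≤ n - x) (g : Equiv.Perm (Fin n)) :
    zonalSpherical (youngSubgroup n m) (irrepCharacter n x) g =
      omega n m x (cosetDistance n m g) := by
  classical
  set w₀ := firstWord n m with hw₀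
  have hwt : weight w₀ = m := weight_firstWord hm
  obtain ⟨z₀, hz₀⟩ := zonalVector_mem_range hx (w₀ := w₀) (by rwa [hwt]) (by rwa [hwt])
  rw [hwt] at hz₀
  have hK : (Nat.card (youngSubgroup n m) : ℂ) ≠ 0 := by exact_mod_cast Nat.card_pos.ne'
  -- The average of the operators of the coset `K g⁻¹` has rank one.
  let T : irrep n x →ₗ[ℂ] irrep n x := (Nat.card (youngSubgroup n m) : ℂ)⁻¹ •
    ∑ k : youngSubgroup n m, Algebra.lsmul ℂ ℂ (irrep n x)
      (MonoidAlgebra.of ℂ (Equiv.Perm (Fin n)) (k * g⁻¹))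
  let f : irrep n x →ₗ[ℂ] ℂ :=
    (EuclideanSpace.proj (w₀ ∘ (g⁻¹ : Equiv.Perm (Fin n))) : Qubits n →L[ℂ] ℂ).toLinearMap ∘ₗ
      spechtHom hx m
  have hf (z : irrep n x) : f z = spechtHom hx m z (w₀ ∘ (g⁻¹ : Equiv.Perm (Fin n))) := rfl
  have hT : T = f.smulRight z₀ := by
    ext1 z
    apply spechtHom_injective hx h1 h2
    have hTz : spechtHom hx m (T z) = (Nat.card (youngSubgroup n m) : ℂ)⁻¹ •
        ∑ k : youngSubgroup n m, permAction n (k : Equiv.Perm (Fin n))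
          (permAction n g⁻¹ (spechtHom hx m z)) := by
      simp only [T, LinearMap.smul_apply, map_smul, LinearMap.sum_apply, map_sum]
      congr 1
      refine sum_congr rfl fun k _ => ?_
      rw [Algebra.lsmul_coe, spechtHom_smul, Representation.asAlgebraHom_of, map_mul,
        Module.End.mul_apply]
    have hsum : ∑ k : youngSubgroup n m, permAction n (k : Equiv.Perm (Fin n))
        (permAction n g⁻¹ (spechtHom hx m z)) = ∑ k ∈ wordStabilizer w₀, permAction n k
          (permAction n g⁻¹ (spechtHom hx m z)) :=
      (sum_subtype (wordStabilizer w₀) (fun k => mem_wordStabilizer.trans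
        mem_youngSubgroup_iff.symm)
        fun k => permAction n k (permAction n g⁻¹ (spechtHom hx m z))).symm
    have hcard : #(wordStabilizer w₀) = Nat.card (youngSubgroup n m) := by
      rw [Nat.card_eq_fintype_card]
      exact (Fintype.card_of_subtype _ fun k => mem_wordStabilizer.trans
        mem_youngSubgroup_iff.symm).symm
    have hmem : permAction n g⁻¹ (spechtHom hx m z) ∈
        LinearMap.range (spechtHom hx (weight w₀)) := by
      rw [hwt]
      exact permAction_mem_range hx m _ ⟨z, rfl⟩
    rw [hTz, hsum, sum_wordStabilizer hx hmem, hcard, smul_smul, inv_mul_cancel_left₀ hK,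
      permAction_apply, LinearMap.smulRight_apply, map_smul, hz₀, hf]
  have htrace : LinearMap.trace ℂ (irrep n x) T =
      zonalSpherical (youngSubgroup n m) (irrepCharacter n x) g := by
    rw [zonalSpherical, map_smul, map_sum, smul_eq_mul]
    congr 1
  rw [← htrace, hT, LinearMap.trace_smulRight, hf, hz₀, zonalVector_apply,
    if_pos (weight_comp _ _), hwt, wordDist_firstWord hm]

end Character

/-! ### The probability mass function -/

section Pmf

variable {n m k l : ℕ}

/-- The words that occur in `|Ξ_{n,m|k,l}⟩`: the first `k` letters are `1^l 0^(k-l)`, and `m - l`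
of the others are `1`. -/
def xiWords (n m k l : ℕ) : Finset (Fin n → Fin 2) :=
  {w | (∀ j ∉ ({j | k ≤ (j : ℕ)} : Finset (Fin n)), w j = if (j : ℕ) < l then 1 else 0) ∧
    #{j ∈ ({j | k ≤ (j : ℕ)} : Finset (Fin n)) | w j = 1} = m - l}

theorem card_tail (hk : k ≤ n) : #{j : Fin n | k ≤ (j : ℕ)} = n - k := by
  have := card_filter_add_card_filter_not (s := (univ : Finset (Fin n))) (fun j => (j : ℕ) < k)
  simp only [not_lt] at this
  rw [Fin.card_filter_val_lt, card_univ, Fintype.card_fin] at this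
  omega

theorem card_xiWords (hk : k ≤ n) : #(xiWords n m k l) = (n - k).choose (m - l) := by
  rw [xiWords, card_words, card_tail hk]

theorem mem_xiWords {w : Fin n → Fin 2} : w ∈ xiWords n m k l ↔
    (∀ j : Fin n, (j : ℕ) < k → w j = if (j : ℕ) < l then 1 else 0) ∧
      #{j : Fin n | k ≤ (j : ℕ) ∧ w j = 1} = m - l := by
  rw [xiWords, mem_filter_univ, filter_filter]
  simp

theorem xi_apply (hlk : l ≤ k) (w : Fin n → Fin 2) : xi n m k l w =
    if w ∈ xiWords n m k l then ((Real.sqrt ((n - k).choose (m - l)) : ℝ) : ℂ)⁻¹ else 0 := by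
  have h : (∀ j : Fin n, ((j : ℕ) < l → w j = 1) ∧ (l ≤ (j : ℕ) → (j : ℕ) < k → w j = 0)) ↔
      ∀ j : Fin n, (j : ℕ) < k → w j = if (j : ℕ) < l then 1 else 0 := by
    refine forall_congr' fun j => ?_
    split_ifs with hj
    · exact ⟨fun h _ => h.1 hj, fun h => ⟨fun _ => h (by omega), fun h' => by omega⟩⟩
    · exact ⟨fun h => h.2 (by omega), fun h => ⟨fun h' => by omega, fun _ => h⟩⟩
  change (if _ then (1 : ℂ) else 0) * (if _ then _ else 0) = _
  rw [if_congr h rfl rfl, if_congr (mem_xiWords (w := w)) rfl rfl]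
  split_ifs <;> simp_all

theorem weight_of_mem_xiWords (hk : k ≤ n) (hlk : l ≤ k) (hlm : l ≤ m) {w : Fin n → Fin 2}
    (hw : w ∈ xiWords n m k l) : weight w = m := by
  obtain ⟨h1, h2⟩ := mem_xiWords.1 hw
  have hs := card_filter_add_card_filter_not (s := univ.filter (fun j => w j = 1))
    (fun j => k ≤ (j : ℕ))
  rw [filter_filter, filter_filter] at hs
  simp only [and_comm (a := w _ = 1)] at hs
  have hl : #{j : Fin n | ¬ k ≤ (j : ℕ) ∧ w j = 1} = l := by
    rw [show l = #{j : Fin n | (j : ℕ) < l} by rw [Fin.card_filter_val_lt]; omega]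
    congr 1
    ext j
    rw [mem_filter_univ, mem_filter_univ]
    constructor
    · rintro ⟨ha, hb⟩
      rw [h1 j (by omega)] at hb
      by_contra hcon
      simp [hcon] at hb
    · intro hj
      exact ⟨by omega, by rw [h1 j (by omega), if_pos hj]⟩
  rw [weight]
  omega

/-- From every word of `|Ξ_{n,m|k,l}⟩` there are `(M choose i) (N choose i)` words of it at
distance `i`: the exchanges have to avoid the first `k` letters. -/
theorem card_xiWords_sphere (hk : k ≤ n) (hlk : l ≤ k) (hlm : l ≤ m) {w : Fin n → Fin 2}
    (hw : w ∈ xiWords n m k l) (i : ℕ) :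
    #{w' ∈ xiWords n m k l | wordDist w w' = i} =
      (m - l).choose i * (n + l - (m + k)).choose i := by
  obtain ⟨h1, h2⟩ := mem_xiWords.1 hw
  have hwt := weight_of_mem_xiWords hk hlk hlm hw
  have hz : #{j : Fin n | k ≤ (j : ℕ) ∧ w j = 0} = n + l - (m + k) := by
    have hs := card_filter_add_card_filter_not (s := univ.filter (fun j : Fin n => k ≤ (j : ℕ)))
      (fun j => w j = 1)
    rw [filter_filter, filter_filter, card_tail hk, h2] at hs
    simp only [fin2_eq_zero_iff, ne_eq]
    omega
  have hset : {w' ∈ xiWords n m k l | wordDist w w' = i} =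
      {w' ∈ sphere w i | ∀ j : Fin n, (j : ℕ) < k → w' j = w j} := by
    ext w'
    rw [mem_filter, mem_filter, mem_sphere]
    constructor
    · rintro ⟨ha, hb⟩
      refine ⟨⟨?_, hb⟩, fun j hj => ?_⟩
      · rw [hwt, weight_of_mem_xiWords hk hlk hlm ha]
      · rw [h1 j hj, (mem_xiWords.1 ha).1 j hj]
    · rintro ⟨⟨ha, hb⟩, hc⟩
      refine ⟨mem_xiWords.2 ⟨fun j hj => by rw [hc j hj, h1 j hj], ?_⟩, hb⟩
      have split (u : Fin n → Fin 2) := card_filter_add_card_filter_not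
        (s := univ.filter (fun j => u j = 1)) (fun j => k ≤ (j : ℕ))
      have s1 := split w
      have s2 := split w'
      rw [filter_filter, filter_filter] at s1 s2
      have hsame : #{j : Fin n | w' j = 1 ∧ ¬ k ≤ (j : ℕ)} =
          #{j : Fin n | w j = 1 ∧ ¬ k ≤ (j : ℕ)} := by
        congr 1
        ext j
        rw [mem_filter_univ, mem_filter_univ]
        exact and_congr_left fun hj => by rw [hc j (by omega)]
      change _ = weight w at s1
      change _ = weight w' at s2
      simp only [and_comm (a := k ≤ _)] at h2 ⊢
      omega
  have hex (R S : Finset (Fin n)) (hR : R ⊆ univ.filter (fun j => w j = 1))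
      (hS : S ⊆ univ.filter (fun j => w j = 0)) :
      (∀ j : Fin n, (j : ℕ) < k → exchange w R S j = w j) ↔
        R ⊆ univ.filter (fun j : Fin n => k ≤ (j : ℕ)) ∧
        S ⊆ univ.filter (fun j : Fin n => k ≤ (j : ℕ)) := by
    simp only [subset_iff, mem_filter_univ] at hR hS ⊢
    constructor
    · intro h
      refine ⟨fun j hj => ?_, fun j hj => ?_⟩
      · by_contra hcon
        have := h j (by omega)
        rw [exchange, if_pos hj, hR hj] at this
        exact absurd this (by decide)
      · by_contra hcon
        have hjR : j ∉ R := fun hjR => absurd ((hR hjR).symm.trans (hS hj)) (by decide)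
        have := h j (by omega)
        rw [exchange, if_neg hjR, if_pos hj, hS hj] at this
        exact absurd this (by decide)
    · rintro ⟨ha, hb⟩ j hj
      rw [exchange, if_neg (fun h => by have := ha h; omega),
        if_neg (fun h => by have := hb h; omega)]
  have restrict (X : Finset (Fin n)) : #{R ∈ powersetCard i X |
      R ⊆ univ.filter (fun j : Fin n => k ≤ (j : ℕ))} =
      (#(X.filter fun j : Fin n => k ≤ (j : ℕ))).choose i := by
    rw [← card_powersetCard]
    congr 1
    ext R
    simp only [mem_filter, mem_powersetCard, subset_iff, mem_univ, true_and]
    constructor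
    · rintro ⟨⟨ha, hb⟩, hc⟩
      exact ⟨fun j hj => ⟨ha hj, hc hj⟩, hb⟩
    · rintro ⟨ha, hb⟩
      exact ⟨⟨fun j hj => (ha hj).1, hb⟩, fun j hj => (ha hj).2⟩
  rw [hset, card_filter, sum_sphere, sum_congr rfl fun R hR => sum_congr rfl fun S hS =>
    if_congr (hex R S (mem_powersetCard.1 hR).1 (mem_powersetCard.1 hS).1) rfl rfl]
  have hprod : ∀ R S : Finset (Fin n), (if R ⊆ univ.filter (fun j : Fin n => k ≤ (j : ℕ)) ∧
      S ⊆ univ.filter (fun j : Fin n => k ≤ (j : ℕ)) then 1 else 0) =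
      (if R ⊆ univ.filter (fun j : Fin n => k ≤ (j : ℕ)) then 1 else 0) *
        (if S ⊆ univ.filter (fun j : Fin n => k ≤ (j : ℕ)) then 1 else 0) := fun R S => by
    split_ifs <;> simp_all
  simp only [hprod]
  rw [← sum_mul_sum, ← card_filter, ← card_filter, restrict, restrict, filter_filter,
    filter_filter]
  simp only [and_comm (b := k ≤ _)]
  rw [h2, hz]

theorem sum_xiWords_omega (hk : k ≤ n) (hlk : l ≤ k) (hlm : l ≤ m) {w : Fin n → Fin 2}
    (hw : w ∈ xiWords n m k l) (f : ℕ → ℂ) :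
    ∑ w' ∈ xiWords n m k l, f (wordDist w w') =
      ∑ i ∈ range (min (m - l) (n + l - (m + k)) + 1),
        ((m - l).choose i : ℂ) * ((n + l - (m + k)).choose i : ℂ) * f i := by
  rw [← sum_fiberwise_of_maps_to (t := range (min (m - l) (n + l - (m + k)) + 1))
    (g := wordDist w)]
  · refine sum_congr rfl fun i _ => ?_
    rw [sum_congr rfl (g := fun _ => f i) fun w' hw' => by rw [(mem_filter.1 hw').2], sum_const,
      card_xiWords_sphere hk hlk hlm hw, nsmul_eq_mul]
    push_cast
    ring
  · intro w' hw'
    have hpos : 0 < #{u ∈ xiWords n m k l | wordDist w u = wordDist w w'} :=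
      card_pos.2 ⟨w', mem_filter.2 ⟨hw', rfl⟩⟩
    rw [card_xiWords_sphere hk hlk hlm hw] at hpos
    have ha := Nat.choose_ne_zero_iff.1 (Nat.pos_of_mul_pos_right hpos).ne'
    have hb := Nat.choose_ne_zero_iff.1 (Nat.pos_of_mul_pos_left hpos).ne'
    rw [mem_range]
    omega

theorem xi_eq_sum (hlk : l ≤ k) : xi n m k l =
    ((Real.sqrt ((n - k).choose (m - l)) : ℝ) : ℂ)⁻¹ •
      ∑ w ∈ xiWords n m k l, EuclideanSpace.single w (1 : ℂ) := by
  ext w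
  rw [xi_apply hlk, PiLp.smul_apply, WithLp.ofLp_sum, Finset.sum_apply]
  simp only [PiLp.single_apply, sum_ite_eq, smul_eq_mul]
  split_ifs <;> simp

theorem pmf_eq_sum {x : ℕ} (hx : 2 * x ≤ n) (hk : k ≤ n) (hlk : l ≤ k) (hlm : l ≤ m)
    (hl : m + k ≤ n + l) (h1 : x ≤ m) (h2 : m ≤ n - x) :
    pmf n m k l x = (zonalNormSq n m x)⁻¹ *
      ∑ i ∈ range (min (m - l) (n + l - (m + k)) + 1),
        ((m - l).choose i : ℂ) * ((n + l - (m + k)).choose i : ℂ) * omega n m x i := by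
  set total := ∑ i ∈ range (min (m - l) (n + l - (m + k)) + 1),
    ((m - l).choose i : ℂ) * ((n + l - (m + k)).choose i : ℂ) * omega n m x i
  have hwt {w : Fin n → Fin 2} (hw : w ∈ xiWords n m k l) : weight w = m :=
    weight_of_mem_xiWords hk hlk hlm hw
  have hentry {w w' : Fin n → Fin 2} (hw : w ∈ xiWords n m k l) (hw' : w' ∈ xiWords n m k l) :
      inner ℂ (EuclideanSpace.single w' (1 : ℂ))
        (isotypicProjector n x (EuclideanSpace.single w (1 : ℂ))) =
        (zonalNormSq n m x)⁻¹ * omega n m x (wordDist w w') := by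
    rw [isotypicProjector_single hx (by rwa [hwt hw]) (by rwa [hwt hw]),
      EuclideanSpace.inner_single_left, PiLp.smul_apply, zonalVector_apply,
      if_pos ((hwt hw').trans (hwt hw).symm), hwt hw, map_one, one_mul, smul_eq_mul]
  have hC : ((n - k).choose (m - l) : ℂ) ≠ 0 := by
    exact_mod_cast (Nat.choose_pos (by omega)).ne'
  have hsq : (((Real.sqrt ((n - k).choose (m - l)) : ℝ) : ℂ))⁻¹ *
      (((Real.sqrt ((n - k).choose (m - l)) : ℝ) : ℂ))⁻¹ = ((n - k).choose (m - l) : ℂ)⁻¹ := by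
    rw [← mul_inv, ← Complex.ofReal_mul, Real.mul_self_sqrt (by positivity), Complex.ofReal_natCast]
  rw [pmf, xi_eq_sum hlk, map_smul, inner_smul_left, inner_smul_right, map_inv₀,
    Complex.conj_ofReal, ← mul_assoc, hsq, map_sum, inner_sum]
  have hrow (w : Fin n → Fin 2) (hw : w ∈ xiWords n m k l) :
      inner ℂ (∑ w' ∈ xiWords n m k l, EuclideanSpace.single w' (1 : ℂ))
        (isotypicProjector n x (EuclideanSpace.single w (1 : ℂ))) =
        (zonalNormSq n m x)⁻¹ * total := by
    rw [sum_inner, sum_congr rfl fun w' hw' => hentry hw hw', ← mul_sum,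
      sum_xiWords_omega hk hlk hlm hw]
  rw [sum_congr rfl hrow, sum_const, card_xiWords hk, nsmul_eq_mul, inv_mul_cancel_left₀ hC]

theorem pmf_eq_zero {x : ℕ} (hx : 2 * x ≤ n) (hk : k ≤ n) (hlk : l ≤ k) (hlm : l ≤ m)
    (h : m < x) : pmf n m k l x = 0 := by
  rw [pmf, PiLp.inner_apply]
  refine sum_eq_zero fun w _ => ?_
  rw [xi_apply hlk]
  split_ifs with hw
  · have hmem : isotypicProjector n x (xi n m k l) ∈ isotypicSubspace n x :=
      Submodule.starProjection_apply_mem _ _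
    rw [isotypicSubspace_apply_eq_zero hx hmem
      (by rwa [weight_of_mem_xiWords hk hlk hlm hw]), inner_zero_right]
  · rw [inner_zero_left]

end Pmf

end HahnPresentation

theorem theorem4p1 (n m k l x : ℕ) (hm : m ≤ n) (hk : k ≤ n) (hlm : l ≤ m) (hlk : l ≤ k)
    (hl : m + k ≤ n + l) (hmn : m ≤ n - m) (hx : x ≤ n / 2) :
    (x ≤ m →
      HahnPresentation.pmf n m k l x =
          ((n.choose x : ℂ) / (n.choose m : ℂ)) *
            (((n : ℂ) - 2 * (x : ℂ) + 1) / ((n : ℂ) - (x : ℂ) + 1)) *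
            ∑ i ∈ Finset.range (min (m - l) (n + l - (m + k)) + 1),
              ((m - l).choose i : ℂ) * ((n + l - (m + k)).choose i : ℂ) *
                HahnPresentation.omega n m x i ∧
      (∀ g : Equiv.Perm (Fin n),
        HahnPresentation.zonalSpherical (HahnPresentation.youngSubgroup n m)
            (HahnPresentation.irrepCharacter n x) g =
          HahnPresentation.omega n m x (HahnPresentation.cosetDistance n m g)) ∧
      (∀ i : ℕ, i ≤ m →
        HahnPresentation.omega n m x i =
          HahnPresentation.hahnPolynomial x (i : ℂ) ((m : ℂ) - (n : ℂ) - 1) (-(m : ℂ) - 1) m)) ∧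
    (m < x → HahnPresentation.pmf n m k l x = 0) := by
  have hx2 : 2 * x ≤ n := by omega
  refine ⟨fun h1 => ⟨?_, fun g => ?_, fun i hi => ?_⟩, fun h =>
    HahnPresentation.pmf_eq_zero hx2 hk hlk hlm h⟩
  · rw [HahnPresentation.pmf_eq_sum hx2 hk hlk hlm hl h1 (by omega),
      HahnPresentation.inv_zonalNormSq hx2 h1 (by omega)]
  · exact HahnPresentation.zonalSpherical_irrepCharacter hm hx2 h1 (by omega) g
  · exact HahnPresentation.omega_eq_hahnPolynomial n m x i h1 (by omega) hm hi (by omega)
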